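/- **Setting.** Let $k\ge 2$ and let $\phi_1,\dots,\phi_k:(0,\infty)\to(0,\infty)$ be $C^1$, increasing, with $\phi_i(x)\to\infty$ as $x\to\infty$, such that - $\int_0^\infty e^{-c\phi_i}\,dx<\infty$ for every $c>0$ and every $i$; - there is $\kappa>1$ such that for each $i\le k-1$, $\phi_i(x)^\kappa<\phi_{i+1}(x)$ for all sufficiently large $x$; - there are $C,M>0$ such that $\frac1C\phi_i(x)^{-M}<\phi_i'(x)<C\phi_i(x)^M$ for all $x>C$ and all $i$. Let $\lambda=\frac1Z e^{-\phi_1}dx$ on $(0,\infty)$, let $\mathbb P=\lambda^{\otimes\mathbb N}$ on $(0,\infty)^{\mathbb N}$ with coordinates $X_1,X_2,\dots$, let $S_n^i=\frac1n\sum_{l=1}^n\phi_i(X_l)$, and for $a=(a_1,\dots,a_k)$ and $\delta>0$ let $C_n^\delta=\bigcap_{i=1}^k\{|S_n^i-a_i|\le\delta\}$. Let $h(\mu)=-\int f\log f\,dx$ if $\mu=f\,dx$ and $h(\mu)=-\infty$ if $\mu\not\ll dx$. Let $\mathcal A_1$ be the interior of the set of $v\in(0,\infty)^{k-1}$ for which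 there is a probability measure $\mu$ on $(0,\infty)$ with $h(\mu)\ne-\infty$, $\int\phi_i\,d\mu=v_i$ for $i\le k-1$ and $\int\phi_k\,d\mu<\infty$. For $v\in\mathcal A_1$ let $g_1(v)$ be the infimum of $\int\phi_k\,d\mu$ over all probability measures $\mu$ on $(0,\infty)$ with $h(\mu)\neq-\infty$ and $\int\phi_i\,d\mu=v_i$ for $i\le k-1$; assume that $g_1$ is continuous on $\mathcal A_1$. Assume that $(a_1,\dots,a_{k-1})\in\mathcal A_1$ and $a_k>g_1(a_1,\dots,a_{k-1})$. Let $H(p)=\log\int e^{p_1\phi_1+\dots+p_k\phi_k}\,d\lambda\in(-\infty,\infty]$ for $p\in\mathbb R^k$, and let $\partial H$ be its subdifferential. Let $\mathcal S_1$ be the set of $v\in\mathcal A_1$ for which there is $(p_1,\dots,p_{k-1})$ such that $v$ is the vector of the first $k-1$ coordinates of some element of $\partial H(p_1,\dots,p_{k-1},0)$ (this $(p_1,\dots,p_{k-1})$ is then unique), let $g_2(v)$ be the infimum of the $k$-th coordinates of the elements of $\partial H(p_1,\dots,p_{k-1},0)$, and let $\mathcal S_2=\mathcal A_1\setminus\mathcal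 S_1$. **Theorem.** There is a probability measure $\lambda^*$ on $(0,\infty)$ such that for every $j\ge1$ $$\lim_{\delta\to0^+}\lim_{n\to\infty}\mathbb P\big((X_1,\dots,X_j)\in\cdot\mid C_n^\delta\big)=(\lambda^*)^{\otimes j},$$ in the sense that for all sufficiently small $\delta>0$ the conditional laws converge weakly to a probability measure as $n\to\infty$, and these limits converge weakly to $(\lambda^*)^{\otimes j}$ as $\delta\to0^+$. Moreover: - If $(a_1,\dots,a_{k-1})\in\mathcal S_1$ and $a_k\ge g_2(a_1,\dots,a_{k-1})$, then $\lambda^*=\frac1Ze^{p_1\phi_1+\dots+p_{k-1}\phi_{k-1}}dx$, where $(p_1,\dots,p_{k-1})$ is the unique vector for which this is a probability measure (with $Z$ the normalizing constant) satisfying $\int\phi_i\,d\lambda^*=a_i$ for $1\le i\le k-1$. In this case the $k$-th constraint is lost in the limit: $\int\phi_k\,d\lambda^*=g_2(a_1,\dots,a_{k-1})$, whatever the value of $a_k\ge g_2(a_1,\dots,a_{k-1})$. - If $(a_1,\dots,a_{k-1})\in\mathcal S_2$, or if $(a_1,\dots,a_{k-1})\in\mathcal S_1$ and $a_k<g_2(a_1,\dots,a_{k-1})$,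 then $\lambda^*=\frac1Ze^{p_1\phi_1+\dots+p_k\phi_k}dx$, where $(p_1,\dots,p_k)$ is the unique vector for which this is a probability measure satisfying $\int\phi_i\,d\lambda^*=a_i$ for all $1\le i\le k$; it satisfies $p_k<0$. -/

import Mathlib

open MeasureTheory ProbabilityTheory Filter Topology
open scoped ENNReal BoundedContinuousFunction

namespace Microcanonical

/-- The half line `(0,∞)`, with its subspace topology and Borel σ-algebra. -/
abbrev PosReal : Type := Set.Ioi (0 : ℝ)

/-- Lebesgue measure on `(0,∞)`. -/
noncomputable def leb : Measure PosReal :=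
  Measure.comap (fun x : PosReal => (x : ℝ)) volume

/-- The standing assumptions on the observables. There are `m + 1` of them, `φ 0, …, φ m`; only
their values on `(0,∞)` matter. -/
structure Observables {m : ℕ} (φ : Fin (m + 1) → ℝ → ℝ) : Prop where
  pos : ∀ i, ∀ x, 0 < x → 0 < φ i x
  contDiff : ∀ i, ContDiffOn ℝ 1 (φ i) (Set.Ioi 0)
  mono : ∀ i, MonotoneOn (φ i) (Set.Ioi 0)
  tendsto : ∀ i, Tendsto (φ i) atTop atTop
  integrable_exp : ∀ i, ∀ c : ℝ, 0 < c →
    IntegrableOn (fun x => Real.exp (-c * φ i x)) (Set.Ioi 0)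
  growth : ∃ κ : ℝ, 1 < κ ∧ ∀ i : Fin m, ∀ᶠ x in atTop, φ i.castSucc x ^ κ < φ i.succ x
  deriv_bound : ∃ C M : ℝ, 0 < C ∧ 0 < M ∧ ∀ i, ∀ x, C < x →
    1 / C * φ i x ^ (-M) < deriv (φ i) x ∧ deriv (φ i) x < C * φ i x ^ M

/-- The projection onto the first `m` coordinates. -/
def proj₁ {m : ℕ} (v : Fin (m + 1) → ℝ) : Fin m → ℝ := fun i => v i.castSucc

/-- The projection onto the last coordinate. -/
def proj₂ {m : ℕ} (v : Fin (m + 1) → ℝ) : ℝ := v (Fin.last m)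

/-- The vector `(p₁, …, pₘ, t)`. -/
def extendBy {m : ℕ} (p : Fin m → ℝ) (t : ℝ) : Fin (m + 1) → ℝ :=
  Fin.snoc (α := fun _ => ℝ) p t

/-- The moment `∫ f dμ ∈ [0,∞]` of a function that is nonnegative on `(0,∞)`. -/
noncomputable def posMoment (f : ℝ → ℝ) (μ : Measure PosReal) : ℝ≥0∞ :=
  ∫⁻ x, ENNReal.ofReal (f x) ∂μ

/-- The measure `Z⁻¹ exp (p₁ φ₁ + ⋯ + pₖ φₖ) dx` on `(0,∞)`. It is a probability measure when the
density is integrable, and the zero measure otherwise. -/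
noncomputable def gibbs {m : ℕ} (φ : Fin (m + 1) → ℝ → ℝ) (p : Fin (m + 1) → ℝ) :
    Measure PosReal :=
  leb.tilted (fun x => ∑ i, p i * φ i x)

/-- The reference law `Z⁻¹ exp (-φ₁) dx` of a single coordinate. -/
noncomputable def refLaw {m : ℕ} (φ : Fin (m + 1) → ℝ → ℝ) : Measure PosReal :=
  leb.tilted (fun x => -φ 0 x)

/-- The reference measure on the configuration space `(0,∞)^ℕ`. -/
noncomputable def refMeasure {m : ℕ} (φ : Fin (m + 1) → ℝ → ℝ) : Measure (ℕ → PosReal) :=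
  Measure.infinitePi (fun _ => refLaw φ)

/-- The empirical mean of `f` over the first `n` coordinates. -/
noncomputable def empMean (f : ℝ → ℝ) (n : ℕ) (ω : ℕ → PosReal) : ℝ :=
  (∑ l ∈ Finset.range n, f (ω l)) / n

/-- The constraint event of width `δ`. -/
def constraint {m : ℕ} (φ : Fin (m + 1) → ℝ → ℝ) (a : Fin (m + 1) → ℝ) (n : ℕ) (δ : ℝ) :
    Set (ℕ → PosReal) :=
  {ω | ∀ i, |empMean (φ i) n ω - a i| ≤ δ}

/-- The law of the first `j` coordinates under the reference measure conditioned on the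
constraint. -/
noncomputable def marginal {m : ℕ} (φ : Fin (m + 1) → ℝ → ℝ) (a : Fin (m + 1) → ℝ) (j n : ℕ)
    (δ : ℝ) : Measure (Fin j → PosReal) :=
  (ProbabilityTheory.cond (refMeasure φ) (constraint φ a n δ)).map (fun ω (l : Fin j) => ω l)

/-- Differential entropy, with values in `[-∞,∞]`: the integral of `-f log f` for the Lebesgue
density `f`, as positive part minus negative part (`⊤ - ⊤ = ⊥`), and `-∞` if there is no density. -/
noncomputable def entropy (μ : Measure PosReal) : EReal :=
  open Classical in
  if μ ≪ leb then
    ((∫⁻ x, ENNReal.ofReal (Real.negMulLog (μ.rnDeriv leb x).toReal) ∂leb : ℝ≥0∞) : EReal) -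
      ((∫⁻ x, ENNReal.ofReal (-Real.negMulLog (μ.rnDeriv leb x).toReal) ∂leb : ℝ≥0∞) : EReal)
  else ⊥

/-- `μ` has entropy different from `-∞` and `∫ φᵢ dμ = vᵢ` for all indices but the last. -/
def IsCompetitor {m : ℕ} (φ : Fin (m + 1) → ℝ → ℝ) (v : Fin m → ℝ)
    (μ : ProbabilityMeasure PosReal) : Prop :=
  entropy (μ : Measure PosReal) ≠ ⊥ ∧
    ∀ i : Fin m, posMoment (φ i.castSucc) (μ : Measure PosReal) = ENNReal.ofReal (v i)

/-- The set of admissible values of the first `k - 1` constraints. -/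
def A₁ {m : ℕ} (φ : Fin (m + 1) → ℝ → ℝ) : Set (Fin m → ℝ) :=
  interior {v | (∀ i, 0 < v i) ∧ ∃ μ : ProbabilityMeasure PosReal,
    IsCompetitor φ v μ ∧ posMoment (φ (Fin.last m)) (μ : Measure PosReal) < ⊤}

/-- The least value of the last moment, given the other ones. It is finite on `A₁`. -/
noncomputable def g₁ {m : ℕ} (φ : Fin (m + 1) → ℝ → ℝ) (v : Fin m → ℝ) : ℝ≥0∞ :=
  sInf {t | ∃ μ : ProbabilityMeasure PosReal,
    IsCompetitor φ v μ ∧ t = posMoment (φ (Fin.last m)) (μ : Measure PosReal)}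

/-- The admissible set. -/
def admissible {m : ℕ} (φ : Fin (m + 1) → ℝ → ℝ) : Set (Fin (m + 1) → ℝ) :=
  {v | proj₁ v ∈ A₁ φ ∧ g₁ φ (proj₁ v) < ENNReal.ofReal (proj₂ v)}

/-- The logarithmic posMoment generating function `H`, with values in `(-∞,∞]`. -/
noncomputable def logMGF {m : ℕ} (φ : Fin (m + 1) → ℝ → ℝ) (p : Fin (m + 1) → ℝ) : EReal :=
  ENNReal.log (∫⁻ x, ENNReal.ofReal (Real.exp (∑ i, p i * φ i x)) ∂(refLaw φ))

/-- The subdifferential at `p` of a proper function with values in `(-∞,∞]`. -/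
def subdifferential {ι : Type*} [Fintype ι] (F : (ι → ℝ) → EReal) (p : ι → ℝ) : Set (ι → ℝ) :=
  {v | ∀ q, F p + ((∑ i, v i * (q i - p i) : ℝ) : EReal) ≤ F q}

/-- The subdifferential of `H` at `(p₁, …, pₖ₋₁, 0)`. -/
def subdiffZero {m : ℕ} (φ : Fin (m + 1) → ℝ → ℝ) (p : Fin m → ℝ) : Set (Fin (m + 1) → ℝ) :=
  subdifferential (logMGF φ) (extendBy p 0)

def S₁ {m : ℕ} (φ : Fin (m + 1) → ℝ → ℝ) : Set (Fin m → ℝ) :=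
  {v | v ∈ A₁ φ ∧ ∃ p : Fin m → ℝ, v ∈ proj₁ '' subdiffZero φ p}

def S₂ {m : ℕ} (φ : Fin (m + 1) → ℝ → ℝ) : Set (Fin m → ℝ) :=
  A₁ φ ∩ (S₁ φ)ᶜ

/-- The infimum of the last coordinates of the subdifferential of `H` at `(p, 0)`, where `p` is
chosen such that `v` lies in the projection of this subdifferential. Such a `p` is unique for `v`
in `S₁`, so that taking the infimum over all of them amounts to choosing it. -/
noncomputable def g₂ {m : ℕ} (φ : Fin (m + 1) → ℝ → ℝ) (v : Fin m → ℝ) : ℝ :=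
  sInf {w | ∃ p : Fin m → ℝ, v ∈ proj₁ '' subdiffZero φ p ∧ w ∈ proj₂ '' subdiffZero φ p}

/-- Iterated weak limit: for all small `δ > 0` the measures `L n δ` converge weakly to a probability
measure as `n → ∞`, and these limits converge weakly to `ν` as `δ → 0+`. -/
def HasIteratedWeakLimit {E : Type*} [TopologicalSpace E] [MeasurableSpace E]
    [OpensMeasurableSpace E] (L : ℕ → ℝ → Measure E) (ν : ProbabilityMeasure E) : Prop :=
  ∃ N : ℝ → ProbabilityMeasure E,
    (∀ᶠ δ in 𝓝[>] (0 : ℝ), ∀ f : E →ᵇ ℝ,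
      Tendsto (fun n => ∫ x, f x ∂(L n δ)) atTop (𝓝 (∫ x, f x ∂(N δ : Measure E)))) ∧
    Tendsto N (𝓝[>] (0 : ℝ)) (𝓝 ν)

end Microcanonical

open Microcanonical

/-! The proof is convex duality combined with a change of measure. For a width `δ ≥ 0`, consider the
dual problem of minimizing `log Z(p) - p·a + δ ‖p‖₁` over parameters `p` whose last coordinate is at
most zero, where `Z` is the partition function relative to the reference law. Its optimality
conditions (`IsOptimal`) say that the tilted law meets the first `k - 1` constraints up to `δ`, does
not exceed the last one by more than `δ`, and satisfies complementary slackness. Continuity of `g₁`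
makes `a` an interior point of the attainable moments. This gives coercivity (`exists_coercive`)
and, with Fatou's lemma, a minimizer (`exists_isOptimal`).

At fixed `δ > 0` the minimum `V` is the exponential rate of the constraint event. On that event the
density of the tilted product law is at least `exp(-nV)` (`setLIntegral_constraint_le`). For the
converse (`eventually_constraint_ge`), tilt by the optimizer of a slightly narrower problem. Its
last moment may fall short of `a_k`, and then a single coordinate with `φ_k` of order `n` supplies
the deficit. Such a coordinate costs only `exp(-o(n))`, because `φ_1` is at most a power `1/κ < 1`
of `φ_k`, and it leaves the other means unchanged in the limit, because `φ_i = o(φ_k)`. This is how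
the last constraint can get lost.

The matching rates, together with exchangeability and an exponential moment bound over disjoint
blocks, force the first `j` coordinates to become independent with the optimal tilted law
(`tendsto_integral_marginal`). As `δ → 0` the relative entropy of the optimizers with respect to the
one of width zero is `O(δ)`, so the laws converge (`integral_tilt_le`).

For width zero, the subdifferential of `H` at a parameter with vanishing last coordinate is
unbounded upwards in the last direction, because `H = +∞` beyond that hyperplane. Its lowest point
is the vector of moments of the tilted law. Hence the optimizer has last coordinate zero exactly
when `a` projects into `S₁` and `a_k ≥ g₂` (`isLeast_g₂`, `exists_isOptimal_zero`). Uniqueness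
follows from strict positivity of relative entropy and linear independence of `1, φ_1, …, φ_k`. -/

namespace Microcanonical

variable {m : ℕ} {φ : Fin (m + 1) → ℝ → ℝ}

/-! ### Domination between observables and exponential integrability. -/

/-- The linear combination `∑ pᵢ φᵢ`, as a function on the half line. -/
noncomputable def pairing (φ : Fin (m + 1) → ℝ → ℝ) (p : Fin (m + 1) → ℝ) (x : PosReal) : ℝ :=
  ∑ i, p i * φ i x

theorem continuous_obs (hφ : Observables φ) (i : Fin (m + 1)) :
    Continuous fun x : PosReal => φ i x :=
  continuousOn_iff_continuous_domRestrict.1 (hφ.contDiff i).continuousOn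

theorem measurable_obs (hφ : Observables φ) (i : Fin (m + 1)) :
    Measurable fun x : PosReal => φ i x :=
  (continuous_obs hφ i).measurable

theorem continuous_pairing (hφ : Observables φ) (p : Fin (m + 1) → ℝ) :
    Continuous (pairing φ p) :=
  continuous_finsetSum _ fun i _ => continuous_const.mul (continuous_obs hφ i)

theorem measurable_pairing (hφ : Observables φ) (p : Fin (m + 1) → ℝ) :
    Measurable (pairing φ p) :=
  (continuous_pairing hφ p).measurable

theorem lintegral_leb (f : ℝ → ℝ≥0∞) : ∫⁻ x : PosReal, f x ∂leb = ∫⁻ x in Set.Ioi (0 : ℝ), f x :=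
  lintegral_subtype_comap measurableSet_Ioi f

theorem integrable_leb_iff {f : ℝ → ℝ} :
    Integrable (fun x : PosReal => f x) leb ↔ IntegrableOn f (Set.Ioi 0) := by
  have he : MeasurableEmbedding (fun x : PosReal => (x : ℝ)) :=
    MeasurableEmbedding.subtype_coe measurableSet_Ioi
  have h : Integrable f (leb.map fun x : PosReal => (x : ℝ)) ↔ _ := he.integrable_map_iff
  rw [IntegrableOn, ← map_comap_subtype_coe measurableSet_Ioi]
  exact h.symm

instance : SigmaFinite leb :=
  SigmaFinite.of_map leb measurable_subtype_coe.aemeasurable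
    (by rw [leb, map_comap_subtype_coe measurableSet_Ioi]; infer_instance)

theorem leb_univ : leb Set.univ = ⊤ := by
  have := lintegral_leb 1
  simpa using this

instance : NeZero leb := ⟨fun h => by simpa [h] using leb_univ⟩

/-- Each observable is negligible against the following ones. -/
theorem obs_isLittleO (hφ : Observables φ) {i j : Fin (m + 1)} (hij : i < j) :
    φ i =o[atTop] φ j := by
  obtain ⟨κ, hκ, hgr⟩ := hφ.growth
  have key : ∀ l : Fin m, φ l.castSucc =o[atTop] φ l.succ := by
    intro l
    rw [Asymptotics.isLittleO_iff]
    intro c hc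
    have h1 : Tendsto (fun x => φ l.castSucc x ^ (κ - 1)) atTop atTop :=
      (tendsto_rpow_atTop (by linarith)).comp (hφ.tendsto _)
    filter_upwards [hgr l, h1.eventually_ge_atTop (1 / c), eventually_gt_atTop 0] with x hx h1 h0
    have hp := hφ.pos l.castSucc x h0
    have hp' := hφ.pos l.succ x h0
    rw [Real.norm_of_nonneg hp.le, Real.norm_of_nonneg hp'.le]
    have : φ l.castSucc x ^ κ = φ l.castSucc x ^ (κ - 1) * φ l.castSucc x := by
      rw [← Real.rpow_add_one hp.ne']; simp
    rw [this] at hx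
    have h2 : 1 / c * φ l.castSucc x ≤ φ l.succ x :=
      (mul_le_mul_of_nonneg_right h1 hp.le).trans hx.le
    calc φ l.castSucc x = c * (1 / c * φ l.castSucc x) := by field_simp
      _ ≤ _ := mul_le_mul_of_nonneg_left h2 hc.le
  induction j using Fin.induction with
  | zero => simp at hij
  | succ j ih =>
    rcases (Fin.le_castSucc_iff.2 hij).lt_or_eq with h | h
    · exact (ih h).trans (key j)
    · exact h ▸ key j

/-- Each observable is dominated by a small power of the last one. -/
theorem exists_rpow_lt_last (hφ : Observables φ) :
    ∃ κ : ℝ, 1 < κ ∧ ∀ i : Fin m, ∀ᶠ x in atTop, φ i.castSucc x ^ κ < φ (Fin.last m) x := by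
  obtain ⟨κ, hκ, hgr⟩ := hφ.growth
  refine ⟨κ, hκ, fun i => ?_⟩
  rcases (Fin.le_last i.succ).lt_or_eq with h | h
  · have := (obs_isLittleO hφ h).bound one_pos
    filter_upwards [this, hgr i, eventually_gt_atTop 0] with x hx h1 h0
    rw [Real.norm_of_nonneg (hφ.pos _ x h0).le, Real.norm_of_nonneg (hφ.pos _ x h0).le] at hx
    linarith
  · exact h ▸ hgr i

/-- The asymptotic domination becomes global because `φ i` is monotone: below the threshold `X` it
is bounded by `φ i X`. -/
theorem obs_le_mul_add (hφ : Observables φ) {i j : Fin (m + 1)} (hij : i < j) {ε : ℝ}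
    (hε : 0 < ε) : ∃ K : ℝ, 0 ≤ K ∧ ∀ x : ℝ, 0 < x → φ i x ≤ ε * φ j x + K := by
  obtain ⟨X, hX⟩ := eventually_atTop.1
    (((obs_isLittleO hφ hij).bound hε).and (eventually_gt_atTop 0))
  have hX0 : 0 < X := (hX X le_rfl).2
  refine ⟨φ i X, (hφ.pos i X hX0).le, fun x hx => ?_⟩
  have hj := hφ.pos j x hx
  rcases le_total X x with h | h
  · have := (hX x h).1
    rw [Real.norm_of_nonneg (hφ.pos _ x hx).le, Real.norm_of_nonneg hj.le] at this
    linarith [hφ.pos i X hX0]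
  · have := hφ.mono i hx hX0 h
    nlinarith

/-- A linear combination is dominated by its top term. -/
theorem abs_sum_le_mul_add (hφ : Observables φ) (j : Fin (m + 1)) (c : Fin (m + 1) → ℝ) {ε : ℝ}
    (hε : 0 < ε) : ∃ K : ℝ, 0 ≤ K ∧ ∀ x : ℝ, 0 < x →
      |∑ i ∈ Finset.univ.filter (· < j), c i * φ i x| ≤ ε * φ j x + K := by
  classical
  set A : ℝ := ∑ i, |c i| with hA
  have hA0 : 0 ≤ A := Finset.sum_nonneg fun i _ => abs_nonneg _
  choose! K hK0 hK using fun i (hi : i < j) =>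
    obs_le_mul_add hφ hi (ε := ε / (A + 1)) (by positivity)
  refine ⟨∑ i ∈ Finset.univ.filter (· < j), |c i| * K i,
    Finset.sum_nonneg fun i hi => mul_nonneg (abs_nonneg _) (hK0 i (by simpa using hi)), ?_⟩
  intro x hx
  have hj := hφ.pos j x hx
  calc |∑ i ∈ Finset.univ.filter (· < j), c i * φ i x|
      ≤ ∑ i ∈ Finset.univ.filter (· < j), |c i| * (ε / (A + 1) * φ j x + K i) := by
        refine (Finset.abs_sum_le_sum_abs _ _).trans (Finset.sum_le_sum fun i hi => ?_)
        rw [abs_mul, abs_of_pos (hφ.pos i x hx)]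
        exact mul_le_mul_of_nonneg_left (hK i (by simpa using hi) x hx) (abs_nonneg _)
    _ = (∑ i ∈ Finset.univ.filter (· < j), |c i|) * (ε / (A + 1) * φ j x)
          + ∑ i ∈ Finset.univ.filter (· < j), |c i| * K i := by
        simp_rw [mul_add, Finset.sum_add_distrib, Finset.sum_mul]
    _ ≤ _ := by
        refine add_le_add ?_ le_rfl
        have h1 : (∑ i ∈ Finset.univ.filter (· < j), |c i|) ≤ A + 1 :=
          (Finset.sum_le_sum_of_subset_of_nonneg (Finset.filter_subset _ _)
            fun _ _ _ => abs_nonneg _).trans (by linarith)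
        calc _ ≤ (A + 1) * (ε / (A + 1) * φ j x) :=
              mul_le_mul_of_nonneg_right h1 (by positivity)
          _ = ε * φ j x := by field_simp

theorem filter_lt_last : (Finset.univ.filter (· < Fin.last m)) =
    Finset.univ.map (Fin.castSuccEmb : Fin m ↪ Fin (m + 1)) := by
  ext i
  induction i using Fin.lastCases <;> simp [Fin.castSucc_lt_last, Fin.castSucc_ne_last]

theorem pairing_eq_add_last (p : Fin (m + 1) → ℝ) (x : PosReal) : pairing φ p x =
    (∑ i ∈ Finset.univ.filter (· < Fin.last m), p i * φ i x)
      + p (Fin.last m) * φ (Fin.last m) x := by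
  rw [pairing, Fin.sum_univ_castSucc, filter_lt_last, Finset.sum_map]
  rfl

/-- Half of the negative top term absorbs all lower terms up to a constant, and the other half is
integrable by assumption. -/
theorem integrable_exp_of_last_neg (hφ : Observables φ) {q : Fin (m + 1) → ℝ}
    (hq : q (Fin.last m) < 0) : Integrable (fun x => Real.exp (pairing φ q x)) leb := by
  obtain ⟨K, -, hK⟩ := abs_sum_le_mul_add hφ (Fin.last m) q (ε := -q (Fin.last m) / 2)
    (by linarith)
  have h1 := ((integrable_leb_iff.2 (hφ.integrable_exp (Fin.last m) (-q (Fin.last m) / 2)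
    (by linarith))).const_mul (Real.exp K))
  refine h1.mono' (measurable_pairing hφ q).exp.aestronglyMeasurable (ae_of_all _ fun x => ?_)
  rw [Real.norm_of_nonneg (Real.exp_pos _).le, ← Real.exp_add, Real.exp_le_exp,
    pairing_eq_add_last]
  have := (abs_le.1 (hK x x.2)).2
  linarith

theorem integrable_exp_neg_obs (hφ : Observables φ) (i : Fin (m + 1)) :
    Integrable (fun x : PosReal => Real.exp (-φ i x)) leb := by
  simpa using integrable_leb_iff.2 (hφ.integrable_exp i 1 one_pos)

theorem isProbabilityMeasure_refLaw (hφ : Observables φ) : IsProbabilityMeasure (refLaw φ) :=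
  isProbabilityMeasure_tilted (integrable_exp_neg_obs hφ 0)

theorem pairing_sub_single (p : Fin (m + 1) → ℝ) (i : Fin (m + 1)) (t : ℝ) (x : PosReal) :
    pairing φ (p - Pi.single i t) x = pairing φ p x - t * φ i x := by
  simp [pairing, sub_mul, Finset.sum_sub_distrib, Pi.single_apply]

theorem integrable_exp_refLaw_iff (hφ : Observables φ) (q : Fin (m + 1) → ℝ) :
    Integrable (fun x => Real.exp (pairing φ q x)) (refLaw φ) ↔
      Integrable (fun x => Real.exp (pairing φ (q - Pi.single 0 1) x)) leb := by
  rw [refLaw, integrable_tilted_iff (integrable_exp_neg_obs hφ 0)]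
  simp_rw [pairing_sub_single, smul_eq_mul, ← Real.exp_add]
  refine iff_of_eq (congrArg (fun f => Integrable f leb) (funext fun x => ?_))
  ring_nf

theorem last_ne_zero (hm : 1 ≤ m) : Fin.last m ≠ 0 := by
  rw [Ne, Fin.ext_iff]; simp; omega

theorem integrable_exp_refLaw_of_last_neg (hm : 1 ≤ m) (hφ : Observables φ)
    {q : Fin (m + 1) → ℝ} (hq : q (Fin.last m) < 0) :
    Integrable (fun x => Real.exp (pairing φ q x)) (refLaw φ) := by
  rw [integrable_exp_refLaw_iff hφ]
  exact integrable_exp_of_last_neg hφ (by simpa [Pi.single_apply, last_ne_zero hm])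

/-- The tilted reference laws are the Gibbs measures, with a shift of the first parameter. -/
theorem refLaw_tilted (hφ : Observables φ) (q : Fin (m + 1) → ℝ) :
    (refLaw φ).tilted (pairing φ q) = gibbs φ (q - Pi.single 0 1) := by
  rw [refLaw, tilted_tilted (integrable_exp_neg_obs hφ 0), gibbs]
  congr 1
  funext x
  have := pairing_sub_single (φ := φ) q 0 1 x
  rw [Pi.add_apply]
  rw [pairing] at this
  rw [this]; ring

/-- A positive top term bounds the exponent below by a constant, while the half line has infinite
Lebesgue measure. So `H` is infinite as soon as the last parameter is positive. -/
theorem not_integrable_of_last_pos (hm : 1 ≤ m) (hφ : Observables φ) {q : Fin (m + 1) → ℝ}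
    (hq : 0 < q (Fin.last m)) :
    ¬ Integrable (fun x => Real.exp (pairing φ q x)) (refLaw φ) := by
  rw [integrable_exp_refLaw_iff hφ]
  intro h
  set r := q - Pi.single 0 1
  have hr : 0 < r (Fin.last m) := by simpa [r, Pi.single_apply, last_ne_zero hm]
  obtain ⟨K, -, hK⟩ := abs_sum_le_mul_add hφ (Fin.last m) r hr
  have h2 : Integrable (fun _ : PosReal => Real.exp (-K)) leb := by
    refine h.mono' aestronglyMeasurable_const (ae_of_all _ fun x => ?_)
    rw [Real.norm_of_nonneg (Real.exp_pos _).le, Real.exp_le_exp, pairing_eq_add_last]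
    have := (abs_le.1 (hK x x.2)).1
    linarith
  rw [integrable_const_iff] at h2
  have := leb_univ
  rcases h2 with h2 | h2
  · exact (Real.exp_pos _).ne' h2
  · exact (h2.measure_univ_lt_top).ne this

/-- The functions `1, φ₁, …, φₖ` are linearly independent. -/
theorem eq_zero_of_pairing_eq_const (hφ : Observables φ) {c : Fin (m + 1) → ℝ} {b : ℝ}
    (h : ∀ x : PosReal, pairing φ c x = b) : c = 0 := by
  classical
  by_contra hc
  obtain ⟨i0, hi0⟩ := Function.ne_iff.1 hc
  let s := Finset.univ.filter fun i => c i ≠ 0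
  have hs : s.Nonempty := ⟨i0, by simpa [s] using hi0⟩
  -- The top nonzero coefficient: half of its term dominates the lower ones, so the combination is
  -- unbounded.
  set j := s.max' hs
  have hj : c j ≠ 0 := by simpa [s] using s.max'_mem hs
  have hgt : ∀ i, j < i → c i = 0 := fun i hi => by
    by_contra h
    exact absurd (s.le_max' i (by simpa [s] using h)) (not_le.2 hi)
  obtain ⟨K, -, hK⟩ := abs_sum_le_mul_add hφ j c (ε := |c j| / 2) (by positivity)
  obtain ⟨x, hx, hx0⟩ := (((hφ.tendsto j).eventually_gt_atTop (2 * (|b| + K) / |c j|)).and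
    (eventually_gt_atTop 0)).exists
  have hsum : pairing φ c ⟨x, hx0⟩ =
      (∑ i ∈ Finset.univ.filter (· < j), c i * φ i x) + c j * φ j x := by
    have : (Finset.univ.filter (· < j)) ∪ {j} ⊆ Finset.univ := Finset.subset_univ _
    rw [pairing, ← Finset.sum_subset this, Finset.sum_union (by simp)]
    · simp
    · intro i _ hi
      simp only [Finset.mem_union, Finset.mem_filter, Finset.mem_univ, true_and,
        Finset.mem_singleton, not_or, not_lt] at hi
      simp [hgt i (lt_of_le_of_ne hi.1 (Ne.symm hi.2))]
  rw [h] at hsum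
  have h1 := hK x hx0
  have hp := hφ.pos j x hx0
  have h2 : |c j| * φ j x ≤ |b| + (|c j| / 2 * φ j x + K) := by
    calc |c j| * φ j x = |b - ∑ i ∈ Finset.univ.filter (· < j), c i * φ i x| := by
          rw [hsum, add_sub_cancel_left, abs_mul, abs_of_pos hp]
      _ ≤ |b| + |∑ i ∈ Finset.univ.filter (· < j), c i * φ i x| := abs_sub _ _
      _ ≤ _ := by linarith
  rw [div_lt_iff₀ (by positivity)] at hx
  linarith

theorem leb_isOpenPosMeasure : leb.IsOpenPosMeasure := by
  refine ⟨fun U hU hne h0 => ?_⟩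
  rw [leb, comap_subtype_coe_apply measurableSet_Ioi] at h0
  have : IsOpen ((↑) '' U : Set ℝ) := isOpen_Ioi.isOpenMap_subtype_val U hU
  exact (this.measure_pos volume (hne.image _)).ne' h0

/-! ### The subexponential cost of one large coordinate. -/

theorem eventually_exp_neg_le {c s t η : ℝ} (hc : 0 < c) (hs : s < 1) (hη : 0 < η) :
    ∀ᶠ x : ℝ in atTop, Real.exp (-η * x) ≤ c * x ^ t * Real.exp (-x ^ s) := by
  have h1 : (fun _ : ℝ => Real.log c) =o[atTop] (fun x : ℝ => x) :=
    Asymptotics.isLittleO_const_id_atTop _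
  have h2 : (fun x : ℝ => t * Real.log x) =o[atTop] (fun x : ℝ => x) :=
    Real.isLittleO_log_id_atTop.const_mul_left t
  have h3 : (fun x : ℝ => x ^ s) =o[atTop] (fun x : ℝ => x) := by
    refine Asymptotics.isLittleO_of_tendsto' ?_ ?_
    · filter_upwards [eventually_gt_atTop 0] with x hx h
      exact absurd h hx.ne'
    · refine (tendsto_rpow_neg_atTop (sub_pos.2 hs)).congr' ?_
      filter_upwards [eventually_gt_atTop 0] with x hx
      rw [neg_sub, Real.rpow_sub_one hx.ne']
  have h4 := ((h1.add h2).sub h3).bound hη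
  filter_upwards [h4, eventually_gt_atTop 0] with x hx h0
  rw [Real.norm_eq_abs, Real.norm_of_nonneg h0.le] at hx
  have h5 := (abs_le.1 hx).1
  have : c * x ^ t * Real.exp (-x ^ s) = Real.exp (Real.log c + t * Real.log x - x ^ s) := by
    rw [sub_eq_add_neg, Real.exp_add, Real.exp_add, Real.exp_log hc,
      Real.rpow_def_of_pos h0, mul_comm t]
  rw [this, Real.exp_le_exp]
  linarith

theorem refLaw_apply {s : Set PosReal} (hs : MeasurableSet s) : refLaw φ s =
    ∫⁻ x in s, ENNReal.ofReal
      (Real.exp (-φ 0 x) / ∫ y : PosReal, Real.exp (-φ 0 y) ∂leb) ∂leb :=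
  tilted_apply' _ _ hs

/-- Lower bound for the probability that the last observable falls in a far away window. -/
theorem refLaw_window_ge (hm : 1 ≤ m) (hφ : Observables φ) {α β η : ℝ} (hα : 0 < α) (hαβ : α < β)
    (hη : 0 < η) : ∀ᶠ t : ℝ in atTop, ENNReal.ofReal (Real.exp (-η * t)) ≤
      refLaw φ {x | α * t ≤ φ (Fin.last m) x ∧ φ (Fin.last m) x ≤ β * t} := by
  obtain ⟨κ, hκ, hgr⟩ := exists_rpow_lt_last hφ
  obtain ⟨C, M, hC, hM, hder⟩ := hφ.deriv_bound
  set Z : ℝ := ∫ y : PosReal, Real.exp (-φ 0 y) ∂leb with hZ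
  have hZ0 : 0 < Z := integral_exp_pos (integrable_exp_neg_obs hφ 0)
  have h0 : (⟨0, hm⟩ : Fin m).castSucc = (0 : Fin (m + 1)) := rfl
  obtain ⟨X, hX⟩ := eventually_atTop.1
    ((hgr ⟨0, hm⟩).and ((eventually_gt_atTop C).and (eventually_gt_atTop 0)))
  have hX0 : 0 < X := (hX X le_rfl).2.2
  have hβ : 0 < β := hα.trans hαβ
  set L := φ (Fin.last m) with hL
  have hcont : ContinuousOn L (Set.Ioi 0) := (hφ.contDiff _).continuousOn
  have hs : κ⁻¹ < 1 := inv_lt_one_of_one_lt₀ hκ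
  -- The constants are those of the product of two lower bounds obtained below: the length of the
  -- window's preimage, `(β - α) t / (C (β t) ^ M)`, and the reference density there, `exp (-(β t) ^
  -- κ⁻¹) / Z`.
  have hexp := (tendsto_id.const_mul_atTop hβ).eventually
    (eventually_exp_neg_le (c := (β - α) / (β * C * Z)) (s := κ⁻¹) (t := 1 - M) (η := η / β)
      (div_pos (sub_pos.2 hαβ) (by positivity)) hs (by positivity))
  filter_upwards [hexp, eventually_ge_atTop (L X / α), eventually_gt_atTop 0] with t ht1 ht2 ht0
  rw [div_le_iff₀ hα] at ht2
  have hαt : 0 < α * t := by positivity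
  have hβt : 0 < β * t := by positivity
  have hαβt : α * t < β * t := by gcongr
  obtain ⟨b, hb, hXb⟩ := (((hφ.tendsto (Fin.last m)).eventually_ge_atTop (β * t)).and
    (eventually_ge_atTop X)).exists
  have hsub : ∀ {u w : ℝ}, 0 < u → Set.Icc u w ⊆ Set.Ioi 0 := fun hu z hz => hu.trans_le hz.1
  obtain ⟨x, hx, hLx⟩ := intermediate_value_Icc hXb (hcont.mono (hsub hX0))
    (show α * t ∈ Set.Icc (L X) (L b) from ⟨by linarith, by linarith⟩)
  have hx0 : 0 < x := hX0.trans_le hx.1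
  obtain ⟨y, hy, hLy⟩ := intermediate_value_Icc hx.2 (hcont.mono (hsub hx0))
    (show β * t ∈ Set.Icc (L x) (L b) from ⟨by linarith, by linarith⟩)
  have hxy : x < y := lt_of_le_of_ne hy.1 (by rintro rfl; linarith)
  have hy0 : 0 < y := hx0.trans hxy
  have hdiff : DifferentiableOn ℝ L (Set.Ioi 0) := (hφ.contDiff _).differentiableOn one_ne_zero
  obtain ⟨c, hc, hslope⟩ := exists_deriv_eq_slope L hxy (hcont.mono (hsub hx0))
    (hdiff.mono (Set.Ioo_subset_Icc_self.trans (hsub hx0)))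
  have hc0 : 0 < c := hx0.trans hc.1
  have hLc : L c ≤ β * t := hLy ▸ hφ.mono _ hc0 hy0 hc.2.le
  -- The upper bound on the derivative prevents the last observable from crossing the window too
  -- fast.
  have hlen : (β - α) * t / (C * (β * t) ^ M) ≤ y - x := by
    have h1 := (hder (Fin.last m) c
      ((hX X le_rfl).2.1.trans_le (hx.1.trans hc.1.le))).2
    rw [← hL, hslope, hLx, hLy, div_lt_iff₀ (sub_pos.2 hxy)] at h1
    rw [div_le_iff₀ (by positivity)]
    have h2 : C * L c ^ M ≤ C * (β * t) ^ M := by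
      have := hφ.pos (Fin.last m) c hc0
      gcongr
    nlinarith [mul_le_mul_of_nonneg_right h2 (sub_pos.2 hxy).le]
  have hφ0 : φ 0 y ≤ (β * t) ^ κ⁻¹ := by
    have h1 := (hX y (hx.1.trans hxy.le)).1
    rw [h0, hLy] at h1
    have hp := hφ.pos 0 y hy0
    calc φ 0 y = (φ 0 y ^ κ) ^ κ⁻¹ := by
          rw [← Real.rpow_mul hp.le, mul_inv_cancel₀ (by linarith), Real.rpow_one]
      _ ≤ _ := Real.rpow_le_rpow (by positivity) h1.le (by positivity)
  set S : Set PosReal := (↑) ⁻¹' Set.Icc x y with hS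
  have hSm : MeasurableSet S := measurable_subtype_coe measurableSet_Icc
  have hvol : leb S = ENNReal.ofReal (y - x) := by
    rw [leb, comap_subtype_coe_apply measurableSet_Ioi, hS, Subtype.image_preimage_coe,
      Set.inter_eq_right.2 (hsub hx0), Real.volume_Icc]
  have hsubset : S ⊆ {x : PosReal | α * t ≤ L x ∧ L x ≤ β * t} := by
    intro z hz
    exact ⟨hLx ▸ hφ.mono _ hx0 z.2 hz.1, hLy ▸ hφ.mono _ z.2 hy0 hz.2⟩
  refine le_trans ?_ (measure_mono hsubset)
  rw [refLaw_apply hSm]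
  calc ENNReal.ofReal (Real.exp (-η * t))
      ≤ ENNReal.ofReal (Real.exp (-(β * t) ^ κ⁻¹) / Z) * ENNReal.ofReal (y - x) := by
        rw [← ENNReal.ofReal_mul (by positivity)]
        refine ENNReal.ofReal_le_ofReal ?_
        have e1 : -(η / β) * (β * id t) = -η * t := by simp only [id]; field_simp
        rw [e1] at ht1
        simp only [id] at ht1
        refine ht1.trans ?_
        have e2 : (β - α) / (β * C * Z) * (β * t) ^ (1 - M) * Real.exp (-(β * t) ^ κ⁻¹) =
            Real.exp (-(β * t) ^ κ⁻¹) / Z * ((β - α) * t / (C * (β * t) ^ M)) := by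
          rw [Real.rpow_sub hβt, Real.rpow_one]
          have : (β * t) ^ M ≠ 0 := by positivity
          field_simp
        rw [e2]
        gcongr
    _ = ∫⁻ _ in S, ENNReal.ofReal (Real.exp (-(β * t) ^ κ⁻¹) / Z) ∂leb := by
        rw [setLIntegral_const, hvol]
    _ ≤ _ := by
        refine setLIntegral_mono' hSm fun z hz => ENNReal.ofReal_le_ofReal ?_
        gcongr
        exact (hφ.mono 0 z.2 hy0 hz.2).trans hφ0

/-! ### Tilted laws and the optimality conditions of the dual problem. -/

/-- The reference law tilted by `∑ pᵢ φᵢ`. -/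
noncomputable def tilt (φ : Fin (m + 1) → ℝ → ℝ) (p : Fin (m + 1) → ℝ) : Measure PosReal :=
  (refLaw φ).tilted (pairing φ p)

/-- The normalizing constant of `tilt φ p`. -/
noncomputable def partition (φ : Fin (m + 1) → ℝ → ℝ) (p : Fin (m + 1) → ℝ) : ℝ :=
  ∫ x, Real.exp (pairing φ p x) ∂refLaw φ

/-- The parameters for which `tilt φ p` is a probability measure. -/
def Normalizable (φ : Fin (m + 1) → ℝ → ℝ) (p : Fin (m + 1) → ℝ) : Prop :=
  Integrable (fun x => Real.exp (pairing φ p x)) (refLaw φ)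

/-- The moments of `tilt φ p`. -/
noncomputable def tiltMoment (φ : Fin (m + 1) → ℝ → ℝ) (p : Fin (m + 1) → ℝ)
    (i : Fin (m + 1)) : ℝ :=
  ∫ x, φ i x ∂tilt φ p

/-- The `ℓ¹` norm of a parameter. -/
def l1 (p : Fin (m + 1) → ℝ) : ℝ := ∑ i, |p i|

theorem l1_nonneg (p : Fin (m + 1) → ℝ) : 0 ≤ l1 p :=
  Finset.sum_nonneg fun _ _ => abs_nonneg _

theorem l1_add_le (p q : Fin (m + 1) → ℝ) : l1 (p + q) ≤ l1 p + l1 q := by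
  rw [l1, l1, l1, ← Finset.sum_add_distrib]
  exact Finset.sum_le_sum fun i _ => abs_add_le _ _

theorem l1_smul (t : ℝ) (p : Fin (m + 1) → ℝ) : l1 (t • p) = |t| * l1 p := by
  simp [l1, abs_mul, Finset.mul_sum]

theorem l1_single (i : Fin (m + 1)) (t : ℝ) : l1 (Pi.single i t) = |t| := by
  rw [l1, Finset.sum_eq_single i] <;> simp +contextual

theorem continuous_l1 : Continuous (l1 : (Fin (m + 1) → ℝ) → ℝ) := by
  unfold l1; fun_prop

/-- The optimality conditions for the entropy maximization problem under the constraints of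
width `δ`, with parameter `p`. -/
structure IsOptimal (φ : Fin (m + 1) → ℝ → ℝ) (a : Fin (m + 1) → ℝ) (δ : ℝ)
    (p : Fin (m + 1) → ℝ) : Prop where
  last_nonpos : p (Fin.last m) ≤ 0
  normalizable : Normalizable φ p
  integrable : ∀ i, Integrable (fun x : PosReal => φ i x) (tilt φ p)
  abs_sub_le : ∀ i : Fin m, |tiltMoment φ p i.castSucc - a i.castSucc| ≤ δ
  last_le : tiltMoment φ p (Fin.last m) ≤ a (Fin.last m) + δ
  slack : ∑ i, p i * (tiltMoment φ p i - a i) ≤ -(δ * l1 p)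

theorem pairing_add (p q : Fin (m + 1) → ℝ) (x : PosReal) :
    pairing φ (p + q) x = pairing φ p x + pairing φ q x := by
  simp [pairing, add_mul, Finset.sum_add_distrib]

theorem pairing_sub (p q : Fin (m + 1) → ℝ) (x : PosReal) :
    pairing φ (p - q) x = pairing φ p x - pairing φ q x := by
  simp [pairing, sub_mul, Finset.sum_sub_distrib]

theorem pairing_smul (t : ℝ) (p : Fin (m + 1) → ℝ) (x : PosReal) :
    pairing φ (t • p) x = t * pairing φ p x := by
  simp [pairing, Finset.mul_sum, mul_assoc]

theorem partition_pos (hφ : Observables φ) {p : Fin (m + 1) → ℝ} (hp : Normalizable φ p) :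
    0 < partition φ p :=
  have := isProbabilityMeasure_refLaw hφ
  integral_exp_pos hp

theorem isProbabilityMeasure_tilt (hφ : Observables φ) {p : Fin (m + 1) → ℝ}
    (hp : Normalizable φ p) : IsProbabilityMeasure (tilt φ p) :=
  have := isProbabilityMeasure_refLaw hφ
  isProbabilityMeasure_tilted hp

theorem normalizable_zero (hφ : Observables φ) : Normalizable φ 0 := by
  have := isProbabilityMeasure_refLaw hφ
  simp [Normalizable, pairing]

theorem partition_zero (hφ : Observables φ) : partition φ 0 = 1 := by
  have := isProbabilityMeasure_refLaw hφ
  simp [partition, pairing]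

theorem integrable_pairing {p q : Fin (m + 1) → ℝ}
    (h : ∀ i, Integrable (fun x : PosReal => φ i x) (tilt φ p)) :
    Integrable (pairing φ q) (tilt φ p) :=
  integrable_finsetSum _ fun i _ => (h i).const_mul _

theorem integral_pairing {p q : Fin (m + 1) → ℝ}
    (h : ∀ i, Integrable (fun x : PosReal => φ i x) (tilt φ p)) :
    ∫ x, pairing φ q x ∂tilt φ p = ∑ i, q i * tiltMoment φ p i := by
  simp_rw [pairing]
  rw [integral_finsetSum _ fun i _ => (h i).const_mul _]
  simp_rw [integral_const_mul]
  rfl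

theorem exp_integral_le {E : Type*} [MeasurableSpace E] {μ : Measure E} [IsProbabilityMeasure μ]
    {g : E → ℝ} (hg : Integrable g μ) (he : Integrable (fun x => Real.exp (g x)) μ) :
    Real.exp (∫ x, g x ∂μ) ≤ ∫ x, Real.exp (g x) ∂μ :=
  convexOn_exp.map_integral_le Real.continuous_exp.continuousOn isClosed_univ
    (ae_of_all _ fun _ => Set.mem_univ _) hg he

/-- Gibbs' inequality: convexity of the log partition function. -/
theorem log_partition_ge (hφ : Observables φ) {p q : Fin (m + 1) → ℝ} (hp : Normalizable φ p)
    (hq : Normalizable φ q) (h : ∀ i, Integrable (fun x : PosReal => φ i x) (tilt φ p)) :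
    Real.log (partition φ p) + ∑ i, (q i - p i) * tiltMoment φ p i ≤
      Real.log (partition φ q) := by
  have := isProbabilityMeasure_tilt hφ hp
  have hZp := partition_pos hφ hp
  have hZq := partition_pos hφ hq
  have e : (fun x => Real.exp ((pairing φ p + pairing φ (q - p)) x)) =
      fun x => Real.exp (pairing φ q x) := by
    funext x; rw [Pi.add_apply, ← pairing_add, add_sub_cancel]
  have h1 : Integrable (fun x => Real.exp (pairing φ (q - p) x)) (tilt φ p) := by
    refine (integrable_tilted_iff hp _).2 ?_
    simp_rw [smul_eq_mul, ← Real.exp_add, ← pairing_add, add_sub_cancel]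
    exact hq
  have h2 := exp_integral_le (integrable_pairing h) h1
  rw [integral_pairing h, tilt, integral_exp_tilted, e] at h2
  change _ ≤ partition φ q / partition φ p at h2
  have h3 := Real.log_le_log (Real.exp_pos _) h2
  rw [Real.log_exp, Real.log_div hZq.ne' hZp.ne'] at h3
  simp only [Pi.sub_apply] at h3
  linarith

/-- The moments lie in the box of half-width `δ` around `a`, extended downwards in the last
direction. A functional with nonpositive last coefficient only gains from that extension. -/
theorem IsOptimal.neg_le_sum {a : Fin (m + 1) → ℝ} {δ : ℝ} {p q : Fin (m + 1) → ℝ}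
    (hp : IsOptimal φ a δ p) (hq : q (Fin.last m) ≤ 0) :
    -(δ * l1 q) ≤ ∑ i, q i * (tiltMoment φ p i - a i) := by
  rw [l1, Finset.mul_sum, ← Finset.sum_neg_distrib]
  refine Finset.sum_le_sum fun i _ => ?_
  induction i using Fin.lastCases with
  | last =>
    rw [abs_of_nonpos hq]
    nlinarith [hp.last_le]
  | cast i =>
    have := mul_le_mul_of_nonneg_left (hp.abs_sub_le i) (abs_nonneg (q i.castSucc))
    rw [← abs_mul] at this
    nlinarith [(abs_le.1 this).1]

/-- The optimality conditions are sufficient for a global minimum by convexity of `log Z`. -/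
theorem IsOptimal.objective_le (hφ : Observables φ) {a : Fin (m + 1) → ℝ} {δ : ℝ}
    {p q : Fin (m + 1) → ℝ} (hp : IsOptimal φ a δ p) (hq : Normalizable φ q)
    (hq0 : q (Fin.last m) ≤ 0) :
    Real.log (partition φ p) - ∑ i, p i * a i + δ * l1 p ≤
      Real.log (partition φ q) - ∑ i, q i * a i + δ * l1 q := by
  have h1 := log_partition_ge hφ hp.normalizable hq hp.integrable
  have h2 := hp.neg_le_sum hq0
  have h3 := hp.slack
  simp only [mul_sub, sub_mul, Finset.sum_sub_distrib] at h1 h2 h3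
  linarith

/-- If `t ↦ ∫ exp (t w)` is at least `1` on `[0,1]`, then `w` is integrable and its integral, the
right derivative at zero, is nonnegative. -/
theorem integrable_of_one_le_integral_exp {E : Type*} [MeasurableSpace E] {μ : Measure E}
    [IsProbabilityMeasure μ] {w : E → ℝ} (hw : Measurable w)
    (he : Integrable (fun x => Real.exp (w x)) μ)
    (h : ∀ t : ℝ, 0 < t → t ≤ 1 → 1 ≤ ∫ x, Real.exp (t * w x) ∂μ) :
    Integrable w μ ∧ 0 ≤ ∫ x, w x ∂μ := by
  have hconv : ∀ t : ℝ, 0 < t → t ≤ 1 → ∀ x,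
      Real.exp (t * w x) ≤ (1 - t) + t * Real.exp (w x) := by
    intro t ht0 ht1 x
    have := convexOn_exp.2 (Set.mem_univ 0) (Set.mem_univ (w x)) (sub_nonneg.2 ht1) ht0.le
      (by ring)
    simpa using this
  have hint : ∀ t : ℝ, 0 < t → t ≤ 1 → Integrable (fun x => Real.exp (t * w x)) μ := by
    intro t ht0 ht1
    refine ((integrable_const (1 - t)).add (he.const_mul t)).mono'
      (hw.const_mul t).exp.aestronglyMeasurable (ae_of_all _ fun x => ?_)
    rw [Real.norm_of_nonneg (Real.exp_pos _).le]
    exact hconv t ht0 ht1 x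
  let t : ℕ → ℝ := fun n => 1 / ((n : ℝ) + 1)
  have ht0 : ∀ n, 0 < t n := fun n => by positivity
  have ht1 : ∀ n, t n ≤ 1 := fun n => by
    simp only [t]; rw [div_le_one (by positivity)]; linarith [n.cast_nonneg (α := ℝ)]
  -- The difference quotients of `t ↦ exp (t w)` are subtracted from the one at `t = 1`. By
  -- convexity the result is nonnegative, so Fatou's lemma applies, and the hypothesis bounds its
  -- integral.
  let g : ℕ → E → ℝ := fun n x => Real.exp (w x) - 1 - (t n)⁻¹ * (Real.exp (t n * w x) - 1)
  have hg0 : ∀ n x, 0 ≤ g n x := by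
    intro n x
    have h1 := mul_le_mul_of_nonneg_left (hconv (t n) (ht0 n) (ht1 n) x) (inv_pos.2 (ht0 n)).le
    have h2 : (t n)⁻¹ * (1 - t n + t n * Real.exp (w x)) =
        (t n)⁻¹ - 1 + Real.exp (w x) := by
      have := (ht0 n).ne'
      field_simp
    rw [h2] at h1
    simp only [g]
    linarith
  have hgm : ∀ n, Measurable (g n) := fun n =>
    (hw.exp.sub_const 1).sub (((hw.const_mul (t n)).exp.sub_const 1).const_mul _)
  have hgi : ∀ n, Integrable (g n) μ := fun n =>
    (he.sub (integrable_const 1)).sub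
      (((hint (t n) (ht0 n) (ht1 n)).sub (integrable_const 1)).const_mul _)
  have hgint : ∀ n, ∫ x, g n x ∂μ ≤ ∫ x, Real.exp (w x) ∂μ - 1 := by
    intro n
    have h1 := h (t n) (ht0 n) (ht1 n)
    have hi := hint (t n) (ht0 n) (ht1 n)
    have h2 : ∫ x, g n x ∂μ = (∫ x, Real.exp (w x) ∂μ - 1) -
        (t n)⁻¹ * (∫ x, Real.exp (t n * w x) ∂μ - 1) := by
      simp only [g]
      have i1 : Integrable (fun x => Real.exp (w x) - 1) μ := he.sub (integrable_const 1)
      have i2 : Integrable (fun x => Real.exp (t n * w x) - 1) μ := hi.sub (integrable_const 1)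
      rw [integral_sub i1 (i2.const_mul _), integral_sub he (integrable_const 1),
        integral_const_mul, integral_sub hi (integrable_const 1)]
      simp
    rw [h2]
    have := mul_nonneg (inv_pos.2 (ht0 n)).le (sub_nonneg.2 h1)
    linarith
  set G : E → ℝ := fun x => Real.exp (w x) - 1 - w x with hG
  have hG0 : ∀ x, 0 ≤ G x := fun x => by
    have := Real.add_one_le_exp (w x)
    simp only [hG]; linarith
  have hGm : Measurable G := (hw.exp.sub_const 1).sub hw
  have httend : Tendsto t atTop (𝓝[≠] 0) := by
    refine tendsto_nhdsWithin_iff.2 ⟨tendsto_one_div_add_atTop_nhds_zero_nat, ?_⟩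
    exact Eventually.of_forall fun n => (ht0 n).ne'
  have hlim : ∀ x, Tendsto (fun n => g n x) atTop (𝓝 (G x)) := by
    intro x
    have hd : HasDerivAt (fun s : ℝ => Real.exp (s * w x)) (w x) 0 := by
      simpa using ((hasDerivAt_id (0 : ℝ)).mul_const (w x)).exp
    have := (hasDerivAt_iff_tendsto_slope_zero.1 hd).comp httend
    simp only [zero_add, zero_mul, Real.exp_zero, smul_eq_mul] at this
    exact tendsto_const_nhds.sub this
  have hfatou : ∫⁻ x, ENNReal.ofReal (G x) ∂μ ≤
      ENNReal.ofReal (∫ x, Real.exp (w x) ∂μ - 1) := by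
    calc ∫⁻ x, ENNReal.ofReal (G x) ∂μ
        = ∫⁻ x, liminf (fun n => ENNReal.ofReal (g n x)) atTop ∂μ := by
          refine lintegral_congr fun x => ?_
          exact ((ENNReal.continuous_ofReal.tendsto _).comp (hlim x)).liminf_eq.symm
      _ ≤ liminf (fun n => ∫⁻ x, ENNReal.ofReal (g n x) ∂μ) atTop :=
          lintegral_liminf_le fun n => (hgm n).ennreal_ofReal
      _ ≤ liminf (fun _ : ℕ => ENNReal.ofReal (∫ x, Real.exp (w x) ∂μ - 1)) atTop := by
          refine liminf_le_liminf (Eventually.of_forall fun n => ?_)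
          rw [← ofReal_integral_eq_lintegral_ofReal (hgi n) (ae_of_all _ (hg0 n))]
          exact ENNReal.ofReal_le_ofReal (hgint n)
      _ = _ := liminf_const _
  have hGi : Integrable G μ := by
    refine ⟨hGm.aestronglyMeasurable, ?_⟩
    rw [hasFiniteIntegral_iff_ofReal (ae_of_all _ hG0)]
    exact hfatou.trans_lt ENNReal.ofReal_lt_top
  have hGint : ∫ x, G x ∂μ ≤ ∫ x, Real.exp (w x) ∂μ - 1 := by
    rw [← ofReal_integral_eq_lintegral_ofReal hGi (ae_of_all _ hG0)] at hfatou
    refine (ENNReal.ofReal_le_ofReal_iff ?_).1 hfatou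
    have := h 1 one_pos le_rfl
    simp only [one_mul] at this
    linarith
  have hwG : w = fun x => (Real.exp (w x) - 1) - G x := by
    funext x; simp only [hG]; ring
  have hi1 : Integrable (fun x => Real.exp (w x) - 1) μ := he.sub (integrable_const 1)
  refine ⟨hwG ▸ hi1.sub hGi, ?_⟩
  have : ∫ x, w x ∂μ = (∫ x, Real.exp (w x) ∂μ - 1) - ∫ x, G x ∂μ := by
    conv_lhs => rw [hwG]
    rw [integral_sub hi1 hGi, integral_sub he (integrable_const 1)]
    simp
  linarith

/-- A minimizer of the dual problem satisfies the optimality conditions. -/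
theorem isOptimal_of_forall_le (hm : 1 ≤ m) (hφ : Observables φ) {a : Fin (m + 1) → ℝ} {δ : ℝ}
    (hδ : 0 ≤ δ) {p : Fin (m + 1) → ℝ} (hp0 : p (Fin.last m) ≤ 0) (hp : Normalizable φ p)
    (hmin : ∀ q : Fin (m + 1) → ℝ, q (Fin.last m) < 0 →
      partition φ p * Real.exp (-(∑ i, p i * a i) + δ * l1 p) ≤
        partition φ q * Real.exp (-(∑ i, q i * a i) + δ * l1 q)) :
    IsOptimal φ a δ p := by
  have := isProbabilityMeasure_tilt hφ hp
  have hZ := partition_pos hφ hp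
  -- One-sided derivative of the objective along the segment from `p` to `q`. A strictly negative
  -- last coordinate of `q` guarantees normalizability along the way, and convexity of `l1` bounds
  -- the penalty on the segment by a linear function.
  have key : ∀ q : Fin (m + 1) → ℝ, q (Fin.last m) < 0 →
      Integrable (pairing φ (q - p)) (tilt φ p) ∧
      0 ≤ ∫ x, pairing φ (q - p) x ∂tilt φ p
        + (-(∑ i, (q i - p i) * a i) + δ * (l1 q - l1 p)) := by
    intro q hq
    set k := -(∑ i, (q i - p i) * a i) + δ * (l1 q - l1 p) with hk
    have h1 := integrable_of_one_le_integral_exp (μ := tilt φ p)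
      (w := fun x => pairing φ (q - p) x + k) ((measurable_pairing hφ _).add_const k) ?_ ?_
    · have hi : Integrable (pairing φ (q - p)) (tilt φ p) := by
        refine (h1.1.sub (integrable_const k)).congr (ae_of_all _ fun x => ?_)
        simp
      refine ⟨hi, ?_⟩
      have := h1.2
      rwa [integral_add hi (integrable_const k), integral_const, probReal_univ, one_smul] at this
    · refine (integrable_tilted_iff hp _).2 ?_
      have e : (fun x => Real.exp (pairing φ p x) • Real.exp (pairing φ (q - p) x + k)) =
          fun x => Real.exp (pairing φ q x) * Real.exp k := by
        funext x
        rw [smul_eq_mul, ← Real.exp_add, ← Real.exp_add, pairing_sub]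
        ring_nf
      rw [e]
      exact (integrable_exp_refLaw_of_last_neg hm hφ hq).mul_const _
    · intro t ht0 ht1
      set qt := p + t • (q - p) with hqt
      have hqt0 : qt (Fin.last m) < 0 := by
        simp only [hqt, Pi.add_apply, Pi.smul_apply, Pi.sub_apply, smul_eq_mul]
        nlinarith
      have h2 := hmin qt hqt0
      rw [tilt, integral_exp_tilted]
      have e : (fun x => Real.exp ((pairing φ p + fun x => t * (pairing φ (q - p) x + k)) x)) =
          fun x => Real.exp (pairing φ qt x) * Real.exp (t * k) := by
        funext x
        rw [Pi.add_apply, ← Real.exp_add, hqt, pairing_add, pairing_smul]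
        ring_nf
      rw [e, integral_mul_const]
      change 1 ≤ partition φ qt * _ / partition φ p
      rw [le_div_iff₀ hZ, one_mul]
      have h3 : l1 qt ≤ (1 - t) * l1 p + t * l1 q := by
        have : qt = (1 - t) • p + t • q := by
          funext i; simp only [hqt, Pi.add_apply, Pi.smul_apply, Pi.sub_apply, smul_eq_mul]; ring
        rw [this]
        refine (l1_add_le _ _).trans ?_
        rw [l1_smul, l1_smul, abs_of_pos ht0, abs_of_nonneg (sub_nonneg.2 ht1)]
      have h4 : (-(∑ i, qt i * a i) + δ * l1 qt) ≤ t * k + (-(∑ i, p i * a i) + δ * l1 p) := by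
        have : ∑ i, qt i * a i = ∑ i, p i * a i + t * ∑ i, (q i - p i) * a i := by
          rw [Finset.mul_sum, ← Finset.sum_add_distrib]
          refine Finset.sum_congr rfl fun i _ => ?_
          simp only [hqt, Pi.add_apply, Pi.smul_apply, Pi.sub_apply, smul_eq_mul]; ring
        rw [this, hk]
        nlinarith [mul_le_mul_of_nonneg_left h3 hδ]
      have h5 := (Real.exp_le_exp.2 h4)
      rw [Real.exp_add (t * k)] at h5
      have hqtZ : 0 ≤ partition φ qt := integral_nonneg fun _ => (Real.exp_pos _).le
      have h6 := h2.trans (mul_le_mul_of_nonneg_left h5 hqtZ)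
      rw [← mul_assoc] at h6
      exact le_of_mul_le_mul_right h6 (Real.exp_pos _)
  -- Lowering the last parameter is always allowed, even when `p` has last coordinate zero. The
  -- derivative in this direction gives integrability of the last observable, and hence of all those
  -- it dominates.
  have hlast : Integrable (fun x : PosReal => φ (Fin.last m) x) (tilt φ p) := by
    have h1 := (key (p - Pi.single (Fin.last m) 1) (by simp; linarith)).1
    refine h1.neg.congr (ae_of_all _ fun x => ?_)
    rw [Pi.neg_apply, pairing_sub (p - Pi.single (Fin.last m) 1), pairing_sub_single]
    ring
  have hint : ∀ i, Integrable (fun x : PosReal => φ i x) (tilt φ p) := by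
    intro i
    rcases (Fin.le_last i).lt_or_eq with h | h
    · obtain ⟨K, -, hK⟩ := obs_le_mul_add hφ h one_pos
      refine ((hlast.const_mul 1).add (integrable_const K)).mono'
        (measurable_obs hφ i).aestronglyMeasurable (ae_of_all _ fun x => ?_)
      rw [Real.norm_of_nonneg (hφ.pos i x x.2).le]
      exact hK x x.2
    · exact h ▸ hlast
  -- The boundary case of last coordinate zero follows by lowering the last coordinate of `q` by `s`
  -- and letting `s → 0+`.
  have key' : ∀ q : Fin (m + 1) → ℝ, q (Fin.last m) ≤ 0 →
      0 ≤ ∑ i, (q i - p i) * (tiltMoment φ p i - a i) + δ * (l1 q - l1 p) := by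
    intro q hq
    have h1 : ∀ s : ℝ, 0 < s → 0 ≤ (∑ i, (q i - p i) * (tiltMoment φ p i - a i)
        + δ * (l1 q - l1 p)) + s * (δ - (tiltMoment φ p (Fin.last m) - a (Fin.last m))) := by
      intro s hs
      set e : Fin (m + 1) → ℝ := Pi.single (Fin.last m) s with he
      have h2 := (key (q - e) (by simp [he]; linarith)).2
      rw [integral_pairing hint] at h2
      have h3 : l1 (q - e) ≤ l1 q + s := by
        rw [he, sub_eq_add_neg, ← Pi.single_neg]
        refine (l1_add_le _ _).trans ?_
        rw [l1_single, abs_neg, abs_of_pos hs]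
      have h4 : ∀ b : Fin (m + 1) → ℝ,
          ∑ i, ((q - e) - p) i * b i =
          ∑ i, (q i - p i) * b i - s * b (Fin.last m) := by
        intro b
        simp only [he, Pi.sub_apply, sub_mul, Finset.sum_sub_distrib, Pi.single_apply, ite_mul,
          zero_mul, Finset.sum_ite_eq', Finset.mem_univ, if_true]
        ring
      have h5 := h4 a
      have h6 := h4 (tiltMoment φ p)
      simp only [Pi.sub_apply] at h5 h6 h2
      rw [h5, h6] at h2
      simp only [mul_sub, Finset.sum_sub_distrib]
      nlinarith [mul_le_mul_of_nonneg_left h3 hδ]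
    have h2 : Tendsto (fun s : ℝ => (∑ i, (q i - p i) * (tiltMoment φ p i - a i)
        + δ * (l1 q - l1 p)) + s * (δ - (tiltMoment φ p (Fin.last m) - a (Fin.last m))))
        (𝓝[>] 0) (𝓝 ((∑ i, (q i - p i) * (tiltMoment φ p i - a i)
        + δ * (l1 q - l1 p)) + 0 * (δ - (tiltMoment φ p (Fin.last m) - a (Fin.last m))))) := by
      refine Tendsto.mono_left (Continuous.tendsto ?_ 0) nhdsWithin_le_nhds
      fun_prop
    rw [zero_mul, add_zero] at h2
    exact ge_of_tendsto h2 (eventually_nhdsWithin_of_forall fun s hs => h1 s hs)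
  have hstep : ∀ (i : Fin (m + 1)) (s : ℝ), 
      (p + Pi.single i s : Fin (m + 1) → ℝ) (Fin.last m) ≤ 0 →
      -(δ * |s|) ≤ s * (tiltMoment φ p i - a i) := by
    intro i s hs
    have h1 := key' _ hs
    have h2 : l1 (p + Pi.single i s) ≤ l1 p + |s| :=
      (l1_add_le _ _).trans_eq (by rw [l1_single])
    simp only [Pi.add_apply, add_sub_cancel_left, Pi.single_apply, ite_mul, zero_mul,
      Finset.sum_ite_eq', Finset.mem_univ, if_true] at h1
    nlinarith [mul_le_mul_of_nonneg_left h2 hδ]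
  refine ⟨hp0, hp, hint, fun i => ?_, ?_, ?_⟩
  · have h1 := hstep i.castSucc 1 (by simpa [Pi.single_apply, (Fin.castSucc_ne_last i).symm] using hp0)
    have h2 := hstep i.castSucc (-1) (by simpa [Pi.single_apply, (Fin.castSucc_ne_last i).symm] using hp0)
    rw [abs_le]
    norm_num at h1 h2
    constructor <;> linarith
  · have h1 := hstep (Fin.last m) (-1) (by simp; linarith)
    norm_num at h1
    linarith
  -- Complementary slackness comes from moving towards the origin.
  · have h1 := key' 0 le_rfl
    simp only [Pi.zero_apply, zero_sub, neg_mul, Finset.sum_neg_distrib] at h1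
    have h2 : l1 (0 : Fin (m + 1) → ℝ) = 0 := by simp [l1]
    rw [h2] at h1
    linarith

/-! ### Entropy bounds, coercivity and existence of a dual minimizer. -/

theorem integrable_of_posMoment_ne_top (hφ : Observables φ) {μ : Measure PosReal}
    {i : Fin (m + 1)} (h : posMoment (φ i) μ ≠ ⊤) : Integrable (fun x : PosReal => φ i x) μ := by
  refine ⟨(measurable_obs hφ i).aestronglyMeasurable, ?_⟩
  rw [hasFiniteIntegral_iff_ofReal (ae_of_all _ fun x : PosReal => (hφ.pos i x x.2).le)]
  exact h.lt_top

theorem posMoment_eq_ofReal_integral (hφ : Observables φ) {μ : Measure PosReal}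
    {i : Fin (m + 1)} (h : Integrable (fun x : PosReal => φ i x) μ) :
    posMoment (φ i) μ = ENNReal.ofReal (∫ x, φ i x ∂μ) :=
  (ofReal_integral_eq_lintegral_ofReal h (ae_of_all _ fun x => (hφ.pos i x x.2).le)).symm

theorem integral_obs_nonneg (hφ : Observables φ) (μ : Measure PosReal) (i : Fin (m + 1)) :
    0 ≤ ∫ x, φ i x ∂μ :=
  integral_nonneg fun x => (hφ.pos i x x.2).le

theorem integral_eq_of_posMoment_eq (hφ : Observables φ) {μ : Measure PosReal}
    {i : Fin (m + 1)} {v : ℝ} (hv : 0 ≤ v) (h : posMoment (φ i) μ = ENNReal.ofReal v) :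
    ∫ x, φ i x ∂μ = v := by
  have h1 := integrable_of_posMoment_ne_top hφ (h ▸ ENNReal.ofReal_ne_top)
  rw [posMoment_eq_ofReal_integral hφ h1] at h
  exact (ENNReal.ofReal_eq_ofReal_iff (integral_obs_nonneg hφ μ i) hv).1 h

/-- The positive part of `log f` is integrable for a density `f` of entropy different
from `-∞`. -/
theorem integrable_posLog_of_entropy_ne_bot {μ : Measure PosReal} [IsProbabilityMeasure μ]
    (h : entropy μ ≠ ⊥) :
    μ ≪ leb ∧ Integrable (fun x => max (Real.log (μ.rnDeriv leb x).toReal) 0) μ := by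
  have hac : μ ≪ leb := by
    by_contra hac
    exact h (by rw [entropy, if_neg hac])
  refine ⟨hac, ?_⟩
  rw [entropy, if_pos hac] at h
  have hm : Measurable fun x => (μ.rnDeriv leb x).toReal :=
    (Measure.measurable_rnDeriv μ leb).ennreal_toReal
  have hfin : ∫⁻ x, ENNReal.ofReal (-Real.negMulLog (μ.rnDeriv leb x).toReal) ∂leb ≠ ⊤ := by
    intro htop
    rw [htop] at h
    simp at h
  rw [← integrable_rnDeriv_smul_iff hac]
  refine ⟨(hm.mul (hm.log.max measurable_const)).aestronglyMeasurable, ?_⟩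
  simp_rw [smul_eq_mul]
  rw [hasFiniteIntegral_iff_ofReal (ae_of_all _ fun x =>
    mul_nonneg ENNReal.toReal_nonneg (le_max_right _ _))]
  refine lt_of_le_of_lt (lintegral_mono fun x => ?_) hfin.lt_top
  rw [Real.negMulLog, neg_mul, neg_neg]
  rcases le_total 0 (Real.log (μ.rnDeriv leb x).toReal) with h0 | h0
  · simp [max_eq_left h0]
  · simp [max_eq_right h0]

/-- The entropic lower bound for the partition function. -/
theorem exists_le_log_partition (hφ : Observables φ) {μ : Measure PosReal}
    [IsProbabilityMeasure μ] (h : entropy μ ≠ ⊥)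
    (hint : ∀ i, Integrable (fun x : PosReal => φ i x) μ) :
    ∃ N : ℝ, ∀ q, Normalizable φ q →
      ∑ i, q i * ∫ x, φ i x ∂μ - N ≤ Real.log (partition φ q) := by
  obtain ⟨hac, hlog⟩ := integrable_posLog_of_entropy_ne_bot h
  set f : PosReal → ℝ := fun x => (μ.rnDeriv leb x).toReal with hf
  set Z0 := ∫ x : PosReal, Real.exp (-φ 0 x) ∂leb with hZ0
  have hZ0pos : 0 < Z0 := integral_exp_pos (integrable_exp_neg_obs hφ 0)
  refine ⟨∫ x, φ 0 x ∂μ + ∫ x, max (Real.log (f x)) 0 ∂μ + Real.log Z0, fun q hq => ?_⟩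
  have hq' := (integrable_exp_refLaw_iff hφ q).1 hq
  -- Jensen's inequality is applied to `g`. The positive part of `log f` suffices, since `f` times
  -- `exp` of minus that part is at most one. It is also all that is known to be integrable: the
  -- entropy may be `+∞`.
  set g : PosReal → ℝ := fun x => pairing φ q x - φ 0 x - max (Real.log (f x)) 0 with hg
  have hpi : Integrable (pairing φ q) μ := integrable_finsetSum _ fun i _ => (hint i).const_mul _
  have hgi : Integrable g μ := (hpi.sub (hint 0)).sub hlog
  have hfm : Measurable f := (Measure.measurable_rnDeriv μ leb).ennreal_toReal
  have hgm : Measurable g := ((measurable_pairing hφ q).sub (measurable_obs hφ 0)).sub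
    (hfm.log.max measurable_const)
  have hbound : ∀ x, f x * Real.exp (g x) ≤
      Real.exp (pairing φ (q - Pi.single 0 1) x) := by
    intro x
    have hf0 : 0 ≤ f x := ENNReal.toReal_nonneg
    have h1 : f x ≤ Real.exp (max (Real.log (f x)) 0) := by
      rcases hf0.eq_or_lt with h0 | h0
      · rw [← h0]; positivity
      · calc f x = Real.exp (Real.log (f x)) := (Real.exp_log h0).symm
          _ ≤ _ := Real.exp_le_exp.2 (le_max_left _ _)
    calc f x * Real.exp (g x) ≤ Real.exp (max (Real.log (f x)) 0) * Real.exp (g x) := by gcongr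
      _ = _ := by
        rw [← Real.exp_add, pairing_sub_single]
        simp only [hg]
        ring_nf
  have hfe : Integrable (fun x => f x * Real.exp (g x)) leb := by
    refine hq'.mono' (hfm.mul hgm.exp).aestronglyMeasurable (ae_of_all _ fun x => ?_)
    rw [Real.norm_of_nonneg (mul_nonneg ENNReal.toReal_nonneg (Real.exp_pos _).le)]
    exact hbound x
  have he : Integrable (fun x => Real.exp (g x)) μ := (integrable_rnDeriv_smul_iff hac).1 hfe
  have h1 := exp_integral_le hgi he
  have h2 : ∫ x, Real.exp (g x) ∂μ = ∫ x, f x * Real.exp (g x) ∂leb :=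
    (integral_rnDeriv_smul hac).symm
  have h3 : ∫ x, f x * Real.exp (g x) ∂leb ≤
      ∫ x, Real.exp (pairing φ (q - Pi.single 0 1) x) ∂leb :=
    integral_mono hfe hq' hbound
  have h4 : partition φ q = (∫ x, Real.exp (pairing φ (q - Pi.single 0 1) x) ∂leb) / Z0 := by
    rw [partition, refLaw, integral_exp_tilted]
    congr 1
    refine integral_congr_ae (ae_of_all _ fun x => ?_)
    simp only [Pi.add_apply, pairing_sub_single]
    ring_nf
  have h5 : Real.exp (∫ x, g x ∂μ) / Z0 ≤ partition φ q := by
    rw [h4]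
    gcongr
    linarith
  have h6 := Real.log_le_log (by positivity) h5
  rw [Real.log_div (Real.exp_pos _).ne' hZ0pos.ne', Real.log_exp] at h6
  have h7 : ∫ x, g x ∂μ = ∑ i, q i * ∫ x, φ i x ∂μ - ∫ x, φ 0 x ∂μ
      - ∫ x, max (Real.log (f x)) 0 ∂μ := by
    have i1 : Integrable (fun x => pairing φ q x - φ 0 x) μ := hpi.sub (hint 0)
    simp only [hg]
    rw [integral_sub i1 hlog, integral_sub hpi (hint 0)]
    simp_rw [pairing]
    rw [integral_finsetSum _ fun i _ => (hint i).const_mul _]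
    simp_rw [integral_const_mul]
    rfl
  linarith

theorem isOpen_A₁ : IsOpen (A₁ φ) := isOpen_interior

theorem pos_of_mem_A₁ {v : Fin m → ℝ} (hv : v ∈ A₁ φ) (i : Fin m) : 0 < v i :=
  (interior_subset hv).1 i

/-- The admissible points are interior: nearby values of the first constraints are attained with a
smaller last moment. -/
theorem exists_competitors (hφ : Observables φ) (hg : ContinuousOn (g₁ φ) (A₁ φ))
    {a : Fin (m + 1) → ℝ} (ha : a ∈ admissible φ) :
    ∃ r > 0, ∀ v : Fin m → ℝ, (∀ i, |v i - a i.castSucc| ≤ r) →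
      ∃ μ : ProbabilityMeasure PosReal, entropy (μ : Measure PosReal) ≠ ⊥ ∧
        (∀ i, Integrable (fun x : PosReal => φ i x) μ) ∧
        (∀ i : Fin m, ∫ x, φ i.castSucc x ∂(μ : Measure PosReal) = v i) ∧
        ∫ x, φ (Fin.last m) x ∂(μ : Measure PosReal) ≤ a (Fin.last m) - r := by
  obtain ⟨hA, hlt⟩ := ha
  obtain ⟨b, hb1, hb2⟩ := exists_between hlt
  have hbtop : b ≠ ⊤ := hb2.ne_top
  -- The only use of continuity of `g₁`: the strict gap below the last constraint persists on a
  -- neighbourhood.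
  have hev : ∀ᶠ v in 𝓝 (proj₁ a), v ∈ A₁ φ ∧ g₁ φ v < b :=
    (isOpen_A₁.eventually_mem hA).and ((hg.continuousAt (isOpen_A₁.mem_nhds hA)).eventually_lt_const hb1)
  obtain ⟨ρ, hρ, hball⟩ := Metric.eventually_nhds_iff.1 hev
  have hgap : 0 < proj₂ a - b.toReal := sub_pos.2 ((ENNReal.lt_ofReal_iff_toReal_lt hbtop).1 hb2)
  refine ⟨min (ρ / 2) (proj₂ a - b.toReal), lt_min (by positivity) hgap, fun v hv => ?_⟩
  obtain ⟨hvA, hvg⟩ := hball (y := v) (by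
    refine lt_of_le_of_lt ((dist_pi_le_iff (by positivity)).2 fun i => ?_) (half_lt_self hρ)
    exact (hv i).trans (min_le_left _ _))
  obtain ⟨t, ⟨μ, hμ, rfl⟩, ht⟩ := sInf_lt_iff.1 hvg
  have hmom : ∀ i : Fin m, ∫ x, φ i.castSucc x ∂(μ : Measure PosReal) = v i := fun i =>
    integral_eq_of_posMoment_eq hφ (pos_of_mem_A₁ hvA i).le (hμ.2 i)
  have hlast := integrable_of_posMoment_ne_top hφ ht.ne_top
  refine ⟨μ, hμ.1, fun i => ?_, hmom, ?_⟩
  · induction i using Fin.lastCases with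
    | last => exact hlast
    | cast i =>
      exact integrable_of_posMoment_ne_top hφ ((hμ.2 i).symm ▸ ENNReal.ofReal_ne_top)
  · rw [posMoment_eq_ofReal_integral hφ hlast, ENNReal.ofReal_lt_iff_lt_toReal
      (integral_obs_nonneg hφ _ _) hbtop] at ht
    have := min_le_right (ρ / 2) (proj₂ a - b.toReal)
    change _ ≤ proj₂ a - _
    linarith

/-- Coercivity of the dual objective. -/
theorem exists_coercive (hφ : Observables φ) (hg : ContinuousOn (g₁ φ) (A₁ φ))
    {a : Fin (m + 1) → ℝ} (ha : a ∈ admissible φ) :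
    ∃ c > 0, ∃ K : ℝ, 0 ≤ K ∧ ∀ q, Normalizable φ q → q (Fin.last m) ≤ 0 →
      c * l1 q - K ≤ Real.log (partition φ q) - ∑ i, q i * a i := by
  obtain ⟨r, hr, hcomp⟩ := exists_competitors hφ hg ha
  -- The corners of the box around the first constraints. There are finitely many, so one constant
  -- serves all of them. For a given `q` the corner matching the signs of its first coordinates
  -- makes each of those terms equal to `r * |q i|`. The last term is at least `r * |q i|` because
  -- the last moment is at most `a - r` and the last coordinate of `q` is nonpositive.
  let v : (Fin m → Bool) → Fin m → ℝ := fun s i => a i.castSucc + if s i then r else -r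
  have hv : ∀ s i, |v s i - a i.castSucc| ≤ r := by
    intro s i
    simp only [v, add_sub_cancel_left]
    split_ifs <;> simp [abs_of_pos hr]
  choose μ hent hint hmom hlast using fun s => hcomp (v s) (hv s)
  choose N hN using fun s => exists_le_log_partition hφ (hent s) (hint s)
  refine ⟨r, hr, ∑ s, |N s|, Finset.sum_nonneg fun _ _ => abs_nonneg _, fun q hq hq0 => ?_⟩
  let s : Fin m → Bool := fun i => decide (0 ≤ q i.castSucc)
  have h1 := hN s q hq
  have h2 : N s ≤ ∑ s, |N s| := (le_abs_self _).trans
    (Finset.single_le_sum (f := fun s => |N s|) (fun _ _ => abs_nonneg _) (Finset.mem_univ s))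
  have h3 : r * l1 q ≤ ∑ i, q i * (∫ x, φ i x ∂(μ s : Measure PosReal) - a i) := by
    rw [l1, Finset.mul_sum]
    refine Finset.sum_le_sum fun i _ => ?_
    induction i using Fin.lastCases with
    | last =>
      rw [abs_of_nonpos hq0]
      nlinarith [hlast s]
    | cast i =>
      rw [hmom s i]
      simp only [v, s, add_sub_cancel_left, decide_eq_true_eq]
      split_ifs with h
      · rw [abs_of_nonneg h, mul_comm]
      · rw [abs_of_neg (not_le.1 h)]
        exact le_of_eq (by ring)
  simp only [mul_sub, Finset.sum_sub_distrib] at h3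
  linarith

/-- Comparison with the parameter `0`, where the objective vanishes. The bound does not depend on
the width `δ`. -/
theorem IsOptimal.mul_l1_le (hφ : Observables φ) {a : Fin (m + 1) → ℝ} {δ : ℝ} (hδ : 0 ≤ δ)
    {p : Fin (m + 1) → ℝ} (hp : IsOptimal φ a δ p) {c K : ℝ}
    (hc : ∀ q, Normalizable φ q → q (Fin.last m) ≤ 0 →
      c * l1 q - K ≤ Real.log (partition φ q) - ∑ i, q i * a i) : c * l1 p ≤ K := by
  have h1 := hp.objective_le hφ (normalizable_zero hφ) le_rfl
  have h2 := hc p hp.normalizable hp.last_nonpos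
  have h3 : l1 (0 : Fin (m + 1) → ℝ) = 0 := by simp [l1]
  rw [partition_zero hφ, h3] at h1
  simp only [Real.log_one, Pi.zero_apply, zero_mul, Finset.sum_const_zero, mul_zero] at h1
  nlinarith [mul_nonneg hδ (l1_nonneg p)]

/-- The dual problem has a solution. -/
theorem exists_isOptimal (hm : 1 ≤ m) (hφ : Observables φ) (hg : ContinuousOn (g₁ φ) (A₁ φ))
    {a : Fin (m + 1) → ℝ} (ha : a ∈ admissible φ) {δ : ℝ} (hδ : 0 ≤ δ) :
    ∃ p, IsOptimal φ a δ p := by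
  obtain ⟨c, hc, K, hK, hcoer⟩ := exists_coercive hφ hg ha
  have := isProbabilityMeasure_refLaw hφ
  let k : (Fin (m + 1) → ℝ) → ℝ := fun q => -(∑ i, q i * a i) + δ * l1 q
  have hk : Continuous k := by
    have := continuous_l1 (m := m)
    fun_prop
  -- The exponential of the objective, extended by `⊤` to parameters that are not normalizable. In
  -- this form lower semicontinuity is Fatou's lemma.
  let G : (Fin (m + 1) → ℝ) → ℝ≥0∞ := fun q =>
    ∫⁻ x, ENNReal.ofReal (Real.exp (pairing φ q x + k q)) ∂refLaw φ
  have hGm : ∀ q, Measurable fun x => ENNReal.ofReal (Real.exp (pairing φ q x + k q)) :=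
    fun q => ((measurable_pairing hφ q).add_const _).exp.ennreal_ofReal
  have hGnorm : ∀ q, Normalizable φ q →
      G q = ENNReal.ofReal (partition φ q * Real.exp (k q)) := by
    intro q hq
    simp only [G, Real.exp_add]
    rw [partition, ← integral_mul_const, ofReal_integral_eq_lintegral_ofReal (hq.mul_const _)
      (ae_of_all _ fun x => by positivity)]
  have hGnorm' : ∀ q, G q ≠ ⊤ → Normalizable φ q := by
    intro q hq
    have h1 : Integrable (fun x => Real.exp (pairing φ q x + k q)) (refLaw φ) := by
      refine ⟨((measurable_pairing hφ q).add_const _).exp.aestronglyMeasurable, ?_⟩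
      rw [hasFiniteIntegral_iff_ofReal (ae_of_all _ fun x => (Real.exp_pos _).le)]
      exact hq.lt_top
    refine (h1.mul_const (Real.exp (-k q))).congr (ae_of_all _ fun x => ?_)
    simp only
    rw [← Real.exp_add]; ring_nf
  have hG0 : G 0 = 1 := by
    simp [G, k, pairing, l1]
  have hlsc : LowerSemicontinuous G := by
    rw [lowerSemicontinuous_iff_isClosed_preimage]
    intro y
    refine IsSeqClosed.isClosed fun u q hu hq => ?_
    calc G q = ∫⁻ x, liminf (fun n => ENNReal.ofReal (Real.exp (pairing φ (u n) x + k (u n))))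
          atTop ∂refLaw φ := by
          refine lintegral_congr fun x => (Tendsto.liminf_eq ?_).symm
          have hcont : Continuous fun q : Fin (m + 1) → ℝ =>
              ENNReal.ofReal (Real.exp (pairing φ q x + k q)) := by
            refine ENNReal.continuous_ofReal.comp ?_
            unfold pairing
            fun_prop
          exact (hcont.tendsto q).comp hq
      _ ≤ liminf (fun n => G (u n)) atTop := lintegral_liminf_le fun n => hGm _
      _ ≤ liminf (fun _ : ℕ => y) atTop := liminf_le_liminf (Eventually.of_forall hu)
      _ = y := liminf_const _
  -- By coercivity a parameter with nonpositive last coordinate and `G q ≤ 1 = G 0` lies in this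
  -- compact set, so a minimizer on it is global.
  let S : Set (Fin (m + 1) → ℝ) := Metric.closedBall 0 (K / c) ∩ {q | q (Fin.last m) ≤ 0}
  have hS : IsCompact S := (isCompact_closedBall _ _).inter_right
    (isClosed_le (continuous_apply _) continuous_const)
  have h0S : (0 : Fin (m + 1) → ℝ) ∈ S :=
    ⟨Metric.mem_closedBall_self (by positivity), le_refl (0 : ℝ)⟩
  obtain ⟨p, hpS, hpmin⟩ := (hlsc.lowerSemicontinuousOn S).exists_isMinOn ⟨0, h0S⟩ hS
  have hmin : ∀ q : Fin (m + 1) → ℝ, q (Fin.last m) ≤ 0 → G p ≤ G q := by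
    intro q hq
    rcases lt_or_ge 1 (G q) with h1 | h1
    · exact ((hpmin h0S).trans_eq hG0).trans h1.le
    · refine hpmin ⟨?_, hq⟩
      have hqn := hGnorm' q (h1.trans_lt ENNReal.one_lt_top).ne
      rw [hGnorm q hqn, ENNReal.ofReal_le_one] at h1
      have hZ := partition_pos hφ hqn
      have h2 := Real.log_le_log (by positivity) h1
      rw [Real.log_mul hZ.ne' (Real.exp_pos _).ne', Real.log_exp, Real.log_one] at h2
      have h3 := hcoer q hqn hq
      have h4 : c * l1 q ≤ K := by
        simp only [k] at h2
        nlinarith [mul_nonneg hδ (l1_nonneg q)]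
      rw [mem_closedBall_zero_iff, pi_norm_le_iff_of_nonneg (by positivity)]
      intro i
      rw [le_div_iff₀ hc, mul_comm, Real.norm_eq_abs]
      refine le_trans (mul_le_mul_of_nonneg_left ?_ hc.le) h4
      exact Finset.single_le_sum (f := fun i => |q i|) (fun _ _ => abs_nonneg _)
        (Finset.mem_univ i)
  have hp : Normalizable φ p :=
    hGnorm' p (((hmin 0 le_rfl).trans_eq hG0).trans_lt ENNReal.one_lt_top).ne
  refine ⟨p, isOptimal_of_forall_le hm hφ hδ hpS.2 hp fun q hq => ?_⟩
  have hqn : Normalizable φ q := integrable_exp_refLaw_of_last_neg hm hφ hq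
  have h1 := hmin q hq.le
  rw [hGnorm p hp, hGnorm q hqn] at h1
  exact (ENNReal.ofReal_le_ofReal_iff
    (mul_nonneg (partition_pos hφ hqn).le (Real.exp_pos _).le)).1 h1

/-! ### The subdifferential of `H`, uniqueness of parameters, and the two regimes. -/

@[simp]
theorem extendBy_castSucc (p : Fin m → ℝ) (t : ℝ) (i : Fin m) :
    extendBy p t i.castSucc = p i := by
  simp [extendBy]

@[simp]
theorem extendBy_last (p : Fin m → ℝ) (t : ℝ) : extendBy p t (Fin.last m) = t := by
  simp [extendBy]

theorem extendBy_proj (P : Fin (m + 1) → ℝ) : extendBy (proj₁ P) (P (Fin.last m)) = P := by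
  funext i
  induction i using Fin.lastCases <;> simp [proj₁]

theorem logMGF_of_normalizable (hφ : Observables φ) {q : Fin (m + 1) → ℝ}
    (hq : Normalizable φ q) : logMGF φ q = (Real.log (partition φ q) : EReal) := by
  have h := ofReal_integral_eq_lintegral_ofReal hq (ae_of_all _ fun x => (Real.exp_pos _).le)
  change ENNReal.log (∫⁻ x, ENNReal.ofReal (Real.exp (pairing φ q x)) ∂refLaw φ) = _
  rw [← h]
  exact ENNReal.log_ofReal_of_pos (partition_pos hφ hq)

theorem logMGF_of_not_normalizable (hφ : Observables φ) {q : Fin (m + 1) → ℝ}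
    (hq : ¬ Normalizable φ q) : logMGF φ q = ⊤ := by
  change ENNReal.log (∫⁻ x, ENNReal.ofReal (Real.exp (pairing φ q x)) ∂refLaw φ) = ⊤
  rw [ENNReal.log_eq_top_iff]
  by_contra h
  refine hq ⟨(measurable_pairing hφ q).exp.aestronglyMeasurable, ?_⟩
  rw [hasFiniteIntegral_iff_ofReal (ae_of_all _ fun x => (Real.exp_pos _).le)]
  exact Ne.lt_top h

/-- The subgradient inequality at `P` says that `P` minimizes `H(q) - q·v`, the dual problem of
width zero at `v`. -/
theorem isOptimal_of_mem_subdifferential (hm : 1 ≤ m) (hφ : Observables φ)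
    {P v : Fin (m + 1) → ℝ} (hP : P (Fin.last m) ≤ 0)
    (hv : v ∈ subdifferential (logMGF φ) P) : IsOptimal φ v 0 P := by
  have hn : Normalizable φ P := by
    by_contra h
    have h1 := hv 0
    rw [logMGF_of_not_normalizable hφ h, logMGF_of_normalizable hφ (normalizable_zero hφ),
      EReal.top_add_coe, top_le_iff] at h1
    exact EReal.coe_ne_top _ h1
  refine isOptimal_of_forall_le hm hφ le_rfl hP hn fun q hq => ?_
  have hqn : Normalizable φ q := integrable_exp_refLaw_of_last_neg hm hφ hq
  have h1 := hv q
  rw [logMGF_of_normalizable hφ hn, logMGF_of_normalizable hφ hqn, ← EReal.coe_add,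
    EReal.coe_le_coe_iff] at h1
  have hZ := partition_pos hφ hn
  have hZq := partition_pos hφ hqn
  rw [← Real.exp_log hZ, ← Real.exp_log hZq, ← Real.exp_add, ← Real.exp_add, Real.exp_le_exp]
  simp only [mul_sub, Finset.sum_sub_distrib] at h1
  simp only [mul_comm _ (v _)]
  linarith

/-- On the hyperplane of vanishing last coordinate, only directions with nonpositive last coordinate
keep `H` finite. Raising the last coordinate of a subgradient therefore preserves the inequality. -/
theorem mem_subdifferential (hm : 1 ≤ m) (hφ : Observables φ) {P v : Fin (m + 1) → ℝ}
    (hP : P (Fin.last m) = 0) (hn : Normalizable φ P)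
    (hint : ∀ i, Integrable (fun x : PosReal => φ i x) (tilt φ P))
    (hv : ∀ i : Fin m, tiltMoment φ P i.castSucc = v i.castSucc)
    (hlast : tiltMoment φ P (Fin.last m) ≤ v (Fin.last m)) :
    v ∈ subdifferential (logMGF φ) P := by
  intro q
  by_cases hq : Normalizable φ q
  · rw [logMGF_of_normalizable hφ hn, logMGF_of_normalizable hφ hq, ← EReal.coe_add,
      EReal.coe_le_coe_iff]
    have hq0 : q (Fin.last m) ≤ 0 := by
      by_contra h
      exact not_integrable_of_last_pos hm hφ (not_le.1 h) hq
    refine le_trans ?_ (log_partition_ge hφ hn hq hint)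
    refine add_le_add le_rfl (Finset.sum_le_sum fun i _ => ?_)
    rw [mul_comm]
    induction i using Fin.lastCases with
    | last => rw [hP]; nlinarith
    | cast i => rw [hv]
  · rw [logMGF_of_not_normalizable hφ hq]
    exact le_top

/-- Relative entropy of two tilted measures: nonnegative, and zero only if they agree. -/
theorem relEntropy_tilt (hφ : Observables φ) {p q : Fin (m + 1) → ℝ} (hp : Normalizable φ p)
    (hq : Normalizable φ q) (hint : Integrable (pairing φ (q - p)) (tilt φ p)) :
    Real.log (partition φ p) + ∫ x, pairing φ (q - p) x ∂tilt φ p ≤ Real.log (partition φ q) ∧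
    (Real.log (partition φ q) ≤ Real.log (partition φ p) + ∫ x, pairing φ (q - p) x ∂tilt φ p →
      p = q) := by
  have := isProbabilityMeasure_tilt hφ hp
  have hZp := partition_pos hφ hp
  have hZq := partition_pos hφ hq
  set k := Real.log (partition φ p) - Real.log (partition φ q) with hk
  -- The log-density of `tilt φ q` with respect to `tilt φ p`; minus its integral is the relative
  -- entropy, written below as the integral of `exp g - (g + 1) ≥ 0`.
  set g : PosReal → ℝ := fun x => pairing φ (q - p) x + k with hg
  have hgi : Integrable g (tilt φ p) := hint.add (integrable_const k)
  have e : (fun x => Real.exp ((pairing φ p + g) x)) =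
      fun x => Real.exp (pairing φ q x) * Real.exp k := by
    funext x
    rw [Pi.add_apply, ← Real.exp_add, hg]
    simp only [pairing_sub]
    ring_nf
  have hei : Integrable (fun x => Real.exp (g x)) (tilt φ p) := by
    refine (integrable_tilted_iff hp _).2 ?_
    simp_rw [smul_eq_mul, ← Real.exp_add]
    change Integrable (fun x => Real.exp ((pairing φ p + g) x)) _
    rw [e]
    exact hq.mul_const _
  have he1 : ∫ x, Real.exp (g x) ∂tilt φ p = 1 := by
    rw [tilt, integral_exp_tilted, e, integral_mul_const]
    change partition φ q * _ / partition φ p = 1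
    rw [hk, Real.exp_sub, Real.exp_log hZp, Real.exp_log hZq]
    field_simp
  have hgI : ∫ x, g x ∂tilt φ p = ∫ x, pairing φ (q - p) x ∂tilt φ p + k := by
    simp only [hg]
    rw [integral_add hint (integrable_const k), integral_const, probReal_univ, one_smul]
  set D : PosReal → ℝ := fun x => Real.exp (g x) - (g x + 1) with hD
  have hD0 : ∀ x, 0 ≤ D x := fun x => sub_nonneg.2 (Real.add_one_le_exp _)
  have hg1 : Integrable (fun x => g x + 1) (tilt φ p) := hgi.add (integrable_const 1)
  have hDi : Integrable D (tilt φ p) := hei.sub hg1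
  have hDI : ∫ x, D x ∂tilt φ p = -∫ x, g x ∂tilt φ p := by
    simp only [hD]
    rw [integral_sub hei hg1, he1, integral_add hgi (integrable_const 1), integral_const,
      probReal_univ, one_smul]
    ring
  have hDI0 : 0 ≤ ∫ x, D x ∂tilt φ p := integral_nonneg hD0
  refine ⟨by linarith, fun hle => ?_⟩
  have hzero : ∫ x, D x ∂tilt φ p = 0 := by linarith
  have hae := (integral_eq_zero_iff_of_nonneg hD0 hDi).1 hzero
  -- Equality almost everywhere passes to Lebesgue measure, then to every point by continuity;
  -- linear independence of `1, φ₁, …, φₖ` concludes.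
  have hac : leb ≪ tilt φ p :=
    (absolutelyContinuous_tilted (integrable_exp_neg_obs hφ 0)).trans
      (absolutelyContinuous_tilted hp)
  have hgc : Continuous g := (continuous_pairing hφ _).add continuous_const
  have := leb_isOpenPosMeasure
  have hall : D = 0 := (Continuous.ae_eq_iff_eq leb
    ((Real.continuous_exp.comp hgc).sub (hgc.add continuous_const)) continuous_zero).1
    (hac.ae_le hae)
  have hqp : q - p = 0 := eq_zero_of_pairing_eq_const hφ (b := -k) fun x => by
    have h1 : Real.exp (g x) - (g x + 1) = 0 := congrFun hall x
    have h2 : g x = 0 := by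
      by_contra h
      have := Real.add_one_lt_exp h
      linarith
    simp only [hg] at h2
    linarith
  exact (sub_eq_zero.1 hqp).symm

/-- A parameter is determined by the moments that it charges. -/
theorem eq_of_tiltMoment_eq (hφ : Observables φ) {p q : Fin (m + 1) → ℝ} (hp : Normalizable φ p)
    (hq : Normalizable φ q)
    (hpi : ∀ i, p i ≠ q i → Integrable (fun x : PosReal => φ i x) (tilt φ p))
    (hqi : ∀ i, p i ≠ q i → Integrable (fun x : PosReal => φ i x) (tilt φ q))
    (h : ∀ i, p i ≠ q i → tiltMoment φ p i = tiltMoment φ q i) : p = q := by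
  have aux : ∀ {p q r : Fin (m + 1) → ℝ},
      (∀ i, p i ≠ q i → Integrable (fun x : PosReal => φ i x) (tilt φ r)) →
      Integrable (pairing φ (q - p)) (tilt φ r) ∧
      ∫ x, pairing φ (q - p) x ∂tilt φ r = ∑ i, (q i - p i) * tiltMoment φ r i := by
    intro p q r hr
    have hi : ∀ i ∈ Finset.univ,
        Integrable (fun x : PosReal => (q - p) i * φ i x) (tilt φ r) := by
      intro i _
      by_cases hpq : p i = q i
      · simp [hpq]
      · exact (hr i hpq).const_mul _
    refine ⟨integrable_finsetSum _ hi, ?_⟩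
    simp_rw [pairing]
    rw [integral_finsetSum _ hi]
    simp_rw [integral_const_mul]
    rfl
  obtain ⟨i1, e1⟩ := aux hpi
  obtain ⟨i2, e2⟩ := aux (p := q) (q := p) fun i hi => hqi i hi.symm
  have h1 := relEntropy_tilt hφ hp hq i1
  have h2 := relEntropy_tilt hφ hq hp i2
  refine h1.2 ?_
  -- The two relative entropies have opposite linear terms, so both vanish. Coordinates where `p`
  -- and `q` agree do not enter, whether or not their moments are finite.
  have e3 : ∑ i, (q i - p i) * tiltMoment φ p i = -∑ i, (p i - q i) * tiltMoment φ q i := by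
    rw [← Finset.sum_neg_distrib]
    refine Finset.sum_congr rfl fun i _ => ?_
    by_cases hpq : p i = q i
    · simp [hpq]
    · rw [h i hpq]; ring
  have h3 := h2.1
  rw [e2] at h3
  rw [e1, e3]
  linarith

theorem gibbs_eq_tilt (hφ : Observables φ) (q : Fin (m + 1) → ℝ) :
    gibbs φ q = tilt φ (q + Pi.single 0 1) := by
  rw [tilt, refLaw_tilted hφ, add_sub_cancel_right]

theorem normalizable_of_gibbs_ne_zero (hφ : Observables φ) {q : Fin (m + 1) → ℝ}
    (h : gibbs φ q ≠ 0) : Normalizable φ (q + Pi.single 0 1) := by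
  by_contra hn
  exact h (by rw [gibbs_eq_tilt hφ, tilt, tilted_of_not_integrable hn])

theorem IsOptimal.tiltMoment_eq {a : Fin (m + 1) → ℝ} {P : Fin (m + 1) → ℝ}
    (hP : IsOptimal φ a 0 P) (i : Fin m) : tiltMoment φ P i.castSucc = a i.castSucc :=
  sub_eq_zero.1 (abs_eq_zero.1 (le_antisymm (hP.abs_sub_le i) (abs_nonneg _)))

theorem IsOptimal.tiltMoment_last_le {a : Fin (m + 1) → ℝ} {P : Fin (m + 1) → ℝ}
    (hP : IsOptimal φ a 0 P) : tiltMoment φ P (Fin.last m) ≤ a (Fin.last m) := by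
  simpa using hP.last_le

/-- Slackness: with the first constraints exact, only the last term survives, and its strictly
negative multiplier forces equality. -/
theorem IsOptimal.tiltMoment_last_eq {a : Fin (m + 1) → ℝ} {P : Fin (m + 1) → ℝ}
    (hP : IsOptimal φ a 0 P) (h : P (Fin.last m) < 0) :
    tiltMoment φ P (Fin.last m) = a (Fin.last m) := by
  refine le_antisymm hP.tiltMoment_last_le ?_
  have h1 := hP.slack
  rw [Fin.sum_univ_castSucc] at h1
  simp only [hP.tiltMoment_eq, sub_self, mul_zero, Finset.sum_const_zero, zero_add, zero_mul,
    neg_zero] at h1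
  nlinarith

/-- Identifies `g₂` with an attained moment. Any other candidate `p` has the same first moments as
`P` and the same last parameter `0`, hence is the same; every subgradient there has last coordinate
at least the moment of the tilted law. -/
theorem isLeast_g₂ (hm : 1 ≤ m) (hφ : Observables φ) {a P : Fin (m + 1) → ℝ}
    (hP : IsOptimal φ a 0 P) (h0 : P (Fin.last m) = 0) :
    IsLeast {w | ∃ p : Fin m → ℝ, proj₁ a ∈ proj₁ '' subdiffZero φ p ∧
      w ∈ proj₂ '' subdiffZero φ p} (tiltMoment φ P (Fin.last m)) := by
  have hext : extendBy (proj₁ P) 0 = P := by rw [← h0, extendBy_proj]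
  constructor
  · refine ⟨proj₁ P, ⟨a, ?_, rfl⟩, ⟨tiltMoment φ P, ?_, rfl⟩⟩
    · rw [subdiffZero, hext]
      exact mem_subdifferential hm hφ h0 hP.normalizable hP.integrable hP.tiltMoment_eq
        hP.tiltMoment_last_le
    · rw [subdiffZero, hext]
      exact mem_subdifferential hm hφ h0 hP.normalizable hP.integrable (fun _ => rfl) le_rfl
  · rintro w ⟨p, ⟨v, hv, hva⟩, ⟨u, hu, rfl⟩⟩
    have hv' := isOptimal_of_mem_subdifferential hm hφ (by simp) hv
    have hu' := isOptimal_of_mem_subdifferential hm hφ (by simp) hu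
    have : P = extendBy p 0 := eq_of_tiltMoment_eq hφ hP.normalizable hv'.normalizable
      (fun i _ => hP.integrable i) (fun i _ => hv'.integrable i) fun i hi => by
        induction i using Fin.lastCases with
        | last => exact absurd (by simp [h0]) hi
        | cast i =>
          rw [hP.tiltMoment_eq, hv'.tiltMoment_eq]
          exact (congrFun hva i).symm
    rw [this]
    exact hu'.tiltMoment_last_le

/-- The optimal parameter for the exact constraints, in the two regimes. -/
theorem exists_isOptimal_zero (hm : 1 ≤ m) (hφ : Observables φ)
    (hg : ContinuousOn (g₁ φ) (A₁ φ)) {a : Fin (m + 1) → ℝ} (ha : a ∈ admissible φ) :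
    ∃ P, IsOptimal φ a 0 P ∧
      (proj₁ a ∈ S₁ φ ∧ g₂ φ (proj₁ a) ≤ proj₂ a →
        P (Fin.last m) = 0 ∧ tiltMoment φ P (Fin.last m) = g₂ φ (proj₁ a)) ∧
      (proj₁ a ∈ S₂ φ ∨ proj₁ a ∈ S₁ φ ∧ proj₂ a < g₂ φ (proj₁ a) → P (Fin.last m) < 0) := by
  by_cases hcase : proj₁ a ∈ S₁ φ ∧ g₂ φ (proj₁ a) ≤ proj₂ a
  · obtain ⟨⟨-, p, v, hv, hva⟩, hle⟩ := id hcase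
    have hP := isOptimal_of_mem_subdifferential hm hφ (by simp) hv
    have hg₂ := (isLeast_g₂ hm hφ hP (by simp)).csInf_eq
    rw [hva] at hg₂
    change g₂ φ (proj₁ a) = _ at hg₂
    refine ⟨extendBy p 0, ⟨by simp, hP.normalizable, hP.integrable, fun i => ?_, ?_, ?_⟩,
      fun _ => ⟨by simp, hg₂.symm⟩, ?_⟩
    · rw [hP.tiltMoment_eq, abs_nonpos_iff, sub_eq_zero]
      exact congrFun hva i
    · rw [add_zero, ← hg₂]
      exact hle
    · rw [Fin.sum_univ_castSucc, extendBy_last, zero_mul, add_zero, zero_mul, neg_zero]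
      refine (Finset.sum_eq_zero fun i _ => ?_).le
      rw [hP.tiltMoment_eq, mul_eq_zero, sub_eq_zero]
      exact Or.inr (congrFun hva i)
    · rintro (h | h)
      · exact absurd hcase.1 h.2
      · exact absurd h.2 (not_lt.2 hle)
  · obtain ⟨P, hP⟩ := exists_isOptimal hm hφ hg ha le_rfl
    refine ⟨P, hP, fun h => absurd h hcase, fun _ => lt_of_le_of_ne hP.last_nonpos fun h0 => ?_⟩
    -- A vanishing last parameter would place `a` in the first regime, which this case excludes.
    have hleast := isLeast_g₂ hm hφ hP h0
    obtain ⟨p, hp, -⟩ := hleast.1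
    refine hcase ⟨⟨ha.1, p, hp⟩, ?_⟩
    rw [g₂, hleast.csInf_eq]
    exact hP.tiltMoment_last_le

/-! ### Infinite products: finite changes of density, blocks and block exchanges. -/

section Product

variable {E : Type*} [MeasurableSpace E] {ι κ : Type*}

/-- The law of a subfamily of independent coordinates. -/
theorem infinitePi_map_comp (μ : ι → Measure E) [∀ i, IsProbabilityMeasure (μ i)] {e : κ → ι}
    (he : Function.Injective e) :
    (Measure.infinitePi μ).map (fun ω k => ω (e k)) = Measure.infinitePi fun k => μ (e k) := by
  have h := (iIndepFun_infinitePi (P := μ) (X := fun _ x => x) fun _ => measurable_id).precomp he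
  have h2 := h.map_fun_eq_infinitePi_map fun k => measurable_pi_apply (e k)
  refine h2.trans ?_
  congr 1
  funext k
  exact Measure.infinitePi_map_eval μ (e k)

theorem infinitePi_map_comp_fintype [Fintype κ] (μ : ι → Measure E)
    [∀ i, IsProbabilityMeasure (μ i)] {e : κ → ι} (he : Function.Injective e) :
    (Measure.infinitePi μ).map (fun ω k => ω (e k)) = Measure.pi fun k => μ (e k) := by
  rw [infinitePi_map_comp μ he, Measure.infinitePi_eq_pi]

/-- A product measure with finitely many factors changed by densities. -/
theorem infinitePi_withDensity (μ ν : ι → Measure E) [∀ i, IsProbabilityMeasure (μ i)]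
    [∀ i, IsProbabilityMeasure (ν i)] (I : Finset ι) {r : ι → E → ℝ≥0∞}
    (hr : ∀ i, Measurable (r i)) (hI : ∀ i ∈ I, ν i = (μ i).withDensity (r i))
    (hIc : ∀ i ∉ I, ν i = μ i) :
    Measure.infinitePi ν = (Measure.infinitePi μ).withDensity fun ω => ∏ i ∈ I, r i (ω i) := by
  classical
  refine (Measure.eq_infinitePi ν fun s t ht => ?_).symm
  have hS : MeasurableSet (Set.pi (s : Set ι) t) :=
    MeasurableSet.pi s.countable_toSet fun i _ => ht i
  rw [withDensity_apply _ hS, ← lintegral_indicator hS]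
  -- Indicator of the cylinder and density are merged into one factor per coordinate, trivial
  -- outside `s ∪ I`, so that independence factorizes the integral.
  let g : ι → E → ℝ≥0∞ := fun i x =>
    (if i ∈ s then (t i).indicator 1 x else 1) * (if i ∈ I then r i x else 1)
  have hg : ∀ i, Measurable (g i) := fun i => by
    refine Measurable.mul ?_ ?_
    · split_ifs
      · exact measurable_one.indicator (ht i)
      · exact measurable_const
    · split_ifs
      · exact hr i
      · exact measurable_const
  have hprod : ∀ ω : ι → E, (Set.pi (s : Set ι) t).indicator (fun ω => ∏ i ∈ I, r i (ω i)) ω =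
      ∏ i ∈ s ∪ I, g i (ω i) := by
    intro ω
    simp only [g]
    rw [Finset.prod_mul_distrib, Finset.prod_ite_mem, Finset.prod_ite_mem,
      Finset.union_inter_cancel_left, Finset.union_inter_cancel_right]
    by_cases hω : ω ∈ Set.pi (s : Set ι) t
    · have h1 : ∏ i ∈ s, (t i).indicator (1 : E → ℝ≥0∞) (ω i) = 1 :=
        Finset.prod_eq_one fun i hi => by rw [Set.indicator_of_mem (hω i hi), Pi.one_apply]
      rw [Set.indicator_of_mem hω, h1, one_mul]
    · rw [Set.indicator_of_notMem hω]
      simp only [Set.mem_pi, not_forall] at hω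
      obtain ⟨i, hi, hn⟩ := hω
      rw [Finset.prod_eq_zero hi (Set.indicator_of_notMem hn _), zero_mul]
  simp_rw [hprod]
  have hind := iIndepFun_infinitePi (P := μ) (X := g) hg
  rw [lintegral_prod_eq_prod_lintegral_of_indepFun _ _ hind
    fun i => (hg i).comp (measurable_pi_apply i)]
  have hfac : ∀ i, ∫⁻ ω, g i (ω i) ∂Measure.infinitePi μ = if i ∈ s then ν i (t i) else 1 := by
    intro i
    rw [← lintegral_map (hg i) (measurable_pi_apply i), Measure.infinitePi_map_eval]
    have h1 : ∀ f : E → ℝ≥0∞, Measurable f →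
        ∫⁻ x, f x * (if i ∈ I then r i x else 1) ∂μ i = ∫⁻ x, f x ∂ν i := by
      intro f hf
      split_ifs with h
      · rw [hI i h, lintegral_withDensity_eq_lintegral_mul _ (hr i) hf]
        simp only [Pi.mul_apply, mul_comm]
      · rw [hIc i h]
        simp
    simp only [g]
    by_cases his : i ∈ s
    · simp only [if_pos his]
      rw [h1 _ (measurable_one.indicator (ht i)), lintegral_indicator_one (ht i)]
    · simp only [if_neg his]
      rw [h1 _ measurable_const]
      simp
  simp_rw [hfac]
  rw [Finset.prod_ite_mem, Finset.union_inter_cancel_left]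

end Product

section Prefix

variable {E : Type*} [MeasurableSpace E]

/-- The product measure on sequences whose first `n` factors are `ν`, the other ones being `μ`. -/
noncomputable def prefixMeasure (μ ν : Measure E) (n : ℕ) : Measure (ℕ → E) :=
  Measure.infinitePi fun l => if l < n then ν else μ

instance isProbabilityMeasure_ite (μ ν : Measure E) [IsProbabilityMeasure μ]
    [IsProbabilityMeasure ν] (c : Prop) [Decidable c] :
    IsProbabilityMeasure (if c then ν else μ) := by
  split_ifs <;> infer_instance

theorem prefixMeasure_tilted (μ : Measure E) [IsProbabilityMeasure μ] {u : E → ℝ}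
    (hu : Measurable u) (hi : Integrable (fun x => Real.exp (u x)) μ) (n : ℕ) :
    prefixMeasure μ (μ.tilted u) n = (Measure.infinitePi fun _ : ℕ => μ).withDensity
      fun ω => ENNReal.ofReal
        (Real.exp (∑ l ∈ Finset.range n, (u (ω l) - Real.log (∫ x, Real.exp (u x) ∂μ)))) := by
  have := isProbabilityMeasure_tilted hi
  have hZ : 0 < ∫ x, Real.exp (u x) ∂μ := integral_exp_pos hi
  rw [prefixMeasure, infinitePi_withDensity (fun _ => μ) _ (Finset.range n)
    (r := fun _ x => ENNReal.ofReal (Real.exp (u x) / ∫ x, Real.exp (u x) ∂μ))]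
  · congr 1
    funext ω
    rw [Real.exp_sum, ENNReal.ofReal_prod_of_nonneg fun _ _ => (Real.exp_pos _).le]
    simp_rw [Real.exp_sub, Real.exp_log hZ]
  · exact fun _ => (hu.exp.div_const _).ennreal_ofReal
  · intro l hl
    rw [if_pos (Finset.mem_range.1 hl)]
    rfl
  · intro l hl
    rw [if_neg (by simpa using hl)]

theorem prefixMeasure_map (μ ν : Measure E) [IsProbabilityMeasure μ] [IsProbabilityMeasure ν]
    {κ : Type*} [Fintype κ] {n : ℕ} {e : κ → ℕ} (he : Function.Injective e) (hn : ∀ k, e k < n) :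
    (prefixMeasure μ ν n).map (fun ω k => ω (e k)) = Measure.pi fun _ => ν := by
  rw [prefixMeasure, infinitePi_map_comp_fintype _ he]
  simp_rw [if_pos (hn _)]

instance isProbabilityMeasure_prefixMeasure (μ ν : Measure E) [IsProbabilityMeasure μ]
    [IsProbabilityMeasure ν] (n : ℕ) : IsProbabilityMeasure (prefixMeasure μ ν n) := by
  unfold prefixMeasure; infer_instance

/-- Position of the `l`-th element of the `b`-th block of length `j`. -/
def blockIndex (j : ℕ) (b : ℕ) (l : Fin j) : ℕ := b * j + l

theorem blockIndex_injective {j : ℕ} :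
    Function.Injective fun p : ℕ × Fin j => blockIndex j p.1 p.2 := by
  rintro ⟨b, l⟩ ⟨b', l'⟩ h
  simp only [blockIndex] at h
  have hj : 0 < j := l.pos
  have h1 : b = b' := by
    have := congrArg (· / j) h
    simpa [Nat.add_comm, Nat.mul_comm _ j, Nat.add_mul_div_left _ _ hj,
      Nat.div_eq_of_lt l.2, Nat.div_eq_of_lt l'.2] using this
  subst h1
  have h2 : l = l' := Fin.ext (by omega)
  rw [h2]

theorem blockIndex_lt {j n b : ℕ} (hb : b < n / j) (l : Fin j) : blockIndex j b l < n := by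
  have h1 : (b + 1) * j ≤ n := (Nat.mul_le_mul_right j hb).trans (Nat.div_mul_le_self n j)
  have := l.2
  simp only [blockIndex]
  rw [Nat.add_mul] at h1
  omega

/-- Integrals of products over blocks. -/
theorem lintegral_prod_blocks (μ ν : Measure E) [IsProbabilityMeasure μ] [IsProbabilityMeasure ν]
    {j n : ℕ} {F : (Fin j → E) → ℝ≥0∞} (hF : Measurable F) :
    ∫⁻ ω, ∏ b ∈ Finset.range (n / j), F (fun l => ω (blockIndex j b l)) ∂prefixMeasure μ ν n =
      (∫⁻ x, F x ∂Measure.pi fun _ => ν) ^ (n / j) := by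
  set R := prefixMeasure μ ν n with hR
  have hY : ∀ b, Measurable fun (ω : ℕ → E) (l : Fin j) => ω (blockIndex j b l) := fun b =>
    measurable_pi_lambda _ fun l => measurable_pi_apply _
  -- Independence holds for all blocks, including those that reach beyond `n`; only the `n / j`
  -- blocks inside the prefix are known to have all factors equal to `ν`.
  have hind : iIndepFun (fun (b : ℕ) (ω : ℕ → E) (l : Fin j) => ω (blockIndex j b l)) R := by
    rw [iIndepFun_iff_map_fun_eq_infinitePi_map hY]
    have h1 := infinitePi_map_comp (fun l => if l < n then ν else μ) (blockIndex_injective (j := j))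
    have h2 : (fun b => R.map fun (ω : ℕ → E) (l : Fin j) => ω (blockIndex j b l)) =
        fun b => Measure.infinitePi fun l => if blockIndex j b l < n then ν else μ := by
      funext b
      exact infinitePi_map_comp _ fun l l' h =>
        (Prod.ext_iff.1 (@blockIndex_injective j (b, l) (b, l') h)).2
    rw [h2, ← Measure.infinitePi_map_curry
      fun b (l : Fin j) => if blockIndex j b l < n then ν else μ, ← h1, Measure.map_map]
    · rfl
    · exact (MeasurableEquiv.curry ℕ (Fin j) E).measurable
    · exact measurable_pi_lambda _ fun l => measurable_pi_apply _
  refine (lintegral_prod_eq_prod_lintegral_of_indepFun _ _ (hind.comp (fun _ => F) fun _ => hF)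
    fun b => hF.comp (hY b)).trans ?_
  refine (Finset.prod_congr rfl fun b hb => ?_).trans
    ((Finset.prod_const _).trans (by rw [Finset.card_range]))
  rw [← prefixMeasure_map μ ν (n := n) (e := blockIndex j b)
    (fun l l' h => (Prod.ext_iff.1 (@blockIndex_injective j (b, l) (b, l') h)).2)
    fun l => blockIndex_lt (Finset.mem_range.1 hb) l, lintegral_map hF (hY b)]
  rfl

/-- The permutation exchanging the first block of length `j` with another one. -/
def blockSwap (j b : ℕ) : ℕ → ℕ := fun i =>
  if i < j then b * j + i else if b * j ≤ i ∧ i < b * j + j then i - b * j else i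

theorem blockSwap_involutive {j b : ℕ} : Function.Involutive (blockSwap j b) := by
  rcases Nat.eq_zero_or_pos b with rfl | hb
  · intro i
    simp only [blockSwap]
    split_ifs <;> omega
  · have : j ≤ b * j := Nat.le_mul_of_pos_left j hb
    intro i
    simp only [blockSwap]
    split_ifs <;> omega

end Prefix

/-! ### Change of measure and the exponential rate of the constraint event. -/

/-- The objective of the dual problem. -/
noncomputable def dualObjective (φ : Fin (m + 1) → ℝ → ℝ) (a : Fin (m + 1) → ℝ) (δ : ℝ)
    (p : Fin (m + 1) → ℝ) : ℝ :=
  Real.log (partition φ p) - ∑ i, p i * a i + δ * l1 p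

theorem measurable_empMean (hφ : Observables φ) (i : Fin (m + 1)) (n : ℕ) :
    Measurable (empMean (φ i) n) :=
  (Finset.measurable_fun_sum _ fun l _ =>
    (measurable_obs hφ i).comp (measurable_pi_apply l)).div_const _

theorem measurableSet_constraint (hφ : Observables φ) (a : Fin (m + 1) → ℝ) (n : ℕ) (δ : ℝ) :
    MeasurableSet (constraint φ a n δ) := by
  have : constraint φ a n δ = ⋂ i, {ω | |empMean (φ i) n ω - a i| ≤ δ} := by
    ext ω; simp [constraint]
  rw [this]
  exact MeasurableSet.iInter fun i =>
    measurableSet_le ((measurable_empMean hφ i n).sub_const _).norm measurable_const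

theorem mul_empMean {f : ℝ → ℝ} {n : ℕ} (hn : n ≠ 0) (ω : ℕ → PosReal) :
    n * empMean f n ω = ∑ l ∈ Finset.range n, f (ω l) := by
  have : (n : ℝ) ≠ 0 := by exact_mod_cast hn
  rw [empMean]; field_simp

theorem sum_pairing (p : Fin (m + 1) → ℝ) (n : ℕ) (ω : ℕ → PosReal) :
    ∑ l ∈ Finset.range n, pairing φ p (ω l) = n * ∑ i, p i * empMean (φ i) n ω := by
  rcases eq_or_ne n 0 with rfl | hn
  · simp
  · simp_rw [pairing]
    rw [Finset.sum_comm, Finset.mul_sum]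
    refine Finset.sum_congr rfl fun i _ => ?_
    rw [← Finset.mul_sum, ← mul_empMean hn]
    ring

/-- A linear functional on a box. -/
theorem abs_sum_sub_le {p s v : Fin (m + 1) → ℝ} {η : ℝ} (h : ∀ i, |s i - v i| ≤ η) :
    |∑ i, p i * s i - ∑ i, p i * v i| ≤ η * l1 p := by
  rw [← Finset.sum_sub_distrib, l1, Finset.mul_sum]
  refine (Finset.abs_sum_le_sum_abs _ _).trans (Finset.sum_le_sum fun i _ => ?_)
  rw [← mul_sub, abs_mul, mul_comm]
  exact mul_le_mul_of_nonneg_right (h i) (abs_nonneg _)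

/-- The density depends on the configuration only through the empirical means, so on a constraint
event it is controlled on the exponential scale from both sides. -/
theorem prefixMeasure_tilt (hφ : Observables φ) {p : Fin (m + 1) → ℝ} (hp : Normalizable φ p)
    (n : ℕ) : prefixMeasure (refLaw φ) (tilt φ p) n = (refMeasure φ).withDensity
      fun ω => ENNReal.ofReal (Real.exp
        (n * (∑ i, p i * empMean (φ i) n ω - Real.log (partition φ p)))) := by
  have := isProbabilityMeasure_refLaw hφ
  rw [tilt, prefixMeasure_tilted (refLaw φ) (measurable_pairing hφ p) hp]
  congr 1
  funext ω
  rw [Finset.sum_sub_distrib, sum_pairing, Finset.sum_const, Finset.card_range, nsmul_eq_mul,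
    mul_sub]
  rfl

theorem measurable_density (hφ : Observables φ) (p : Fin (m + 1) → ℝ) (n : ℕ) (c : ℝ) :
    Measurable fun ω : ℕ → PosReal => ENNReal.ofReal (Real.exp
        (n * (∑ i, p i * empMean (φ i) n ω - c))) :=
  (((Finset.measurable_fun_sum _ fun i _ =>
    (measurable_empMean hφ i n).const_mul _).sub_const _).const_mul _).exp.ennreal_ofReal

/-- On the constraint, the reference measure is bounded by the tilted one. -/
theorem setLIntegral_constraint_le (hφ : Observables φ) {p : Fin (m + 1) → ℝ}
    (hp : Normalizable φ p) (a : Fin (m + 1) → ℝ) (n : ℕ) (δ : ℝ) {F : (ℕ → PosReal) → ℝ≥0∞}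
    (hF : Measurable F) :
    ∫⁻ ω in constraint φ a n δ, F ω ∂refMeasure φ ≤
      ENNReal.ofReal (Real.exp (n * dualObjective φ a δ p)) *
        ∫⁻ ω, F ω ∂prefixMeasure (refLaw φ) (tilt φ p) n := by
  rw [prefixMeasure_tilt hφ hp,
    lintegral_withDensity_eq_lintegral_mul _ (measurable_density hφ p n _) hF,
    ← lintegral_const_mul _ ((measurable_density hφ p n _).mul hF)]
  refine le_trans ?_ (setLIntegral_le_lintegral (constraint φ a n δ) _)
  refine setLIntegral_mono' (measurableSet_constraint hφ a n δ) fun ω hω => ?_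
  rw [Pi.mul_apply, ← mul_assoc, ← ENNReal.ofReal_mul (Real.exp_pos _).le, ← Real.exp_add]
  refine le_mul_of_one_le_left' (ENNReal.one_le_ofReal.2 (Real.one_le_exp ?_))
  have h1 := (abs_le.1 (abs_sum_sub_le (p := p) hω)).1
  rw [← mul_add]
  refine mul_nonneg n.cast_nonneg ?_
  rw [dualObjective]
  linarith

theorem tendsto_empMean_ae (hφ : Observables φ) {p : Fin (m + 1) → ℝ} (hp : Normalizable φ p)
    {i : Fin (m + 1)} (hi : Integrable (fun x : PosReal => φ i x) (tilt φ p)) :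
    ∀ᵐ ω ∂(Measure.infinitePi fun _ : ℕ => tilt φ p),
      Tendsto (fun n => empMean (φ i) n ω) atTop (𝓝 (tiltMoment φ p i)) := by
  have := isProbabilityMeasure_tilt hφ hp
  set Q := Measure.infinitePi fun _ : ℕ => tilt φ p with hQ
  have hmeas : Measurable fun x : PosReal => φ i x := measurable_obs hφ i
  have hpres : ∀ l : ℕ, MeasurePreserving (fun ω : ℕ → PosReal => ω l) Q (tilt φ p) := fun l =>
    measurePreserving_eval_infinitePi (fun _ : ℕ => tilt φ p) l
  have h := strong_law_ae_real (μ := Q) (fun l (ω : ℕ → PosReal) => φ i (ω l))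
    ((hpres 0).integrable_comp_of_integrable hi)
    (fun k l hkl => (iIndepFun_infinitePi (P := fun _ : ℕ => tilt φ p)
      (X := fun _ (x : PosReal) => φ i x) fun _ => hmeas).indepFun hkl)
    (fun l => ⟨(hmeas.comp (measurable_pi_apply l)).aemeasurable,
      (hmeas.comp (measurable_pi_apply 0)).aemeasurable, by
        change Q.map ((fun x : PosReal => φ i x) ∘ fun ω => ω l) =
          Q.map ((fun x : PosReal => φ i x) ∘ fun ω => ω 0)
        rw [← Measure.map_map hmeas (measurable_pi_apply l),
          ← Measure.map_map hmeas (measurable_pi_apply 0), (hpres l).map_eq, (hpres 0).map_eq]⟩)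
  have hint : ∫ ω, φ i (ω 0) ∂Q = tiltMoment φ p i := by
    rw [tiltMoment, ← (hpres 0).map_eq, integral_map (measurable_pi_apply 0).aemeasurable
      hmeas.aestronglyMeasurable]
  rw [hint] at h
  exact h

/-- The law of large numbers for the tilted measure. -/
theorem eventually_half_le_constraint (hφ : Observables φ) {p : Fin (m + 1) → ℝ}
    (hp : Normalizable φ p) (hi : ∀ i, Integrable (fun x : PosReal => φ i x) (tilt φ p))
    {η : ℝ} (hη : 0 < η) : ∀ᶠ n in atTop,
      1 / 2 ≤ prefixMeasure (refLaw φ) (tilt φ p) n (constraint φ (tiltMoment φ p) n η) := by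
  have := isProbabilityMeasure_refLaw hφ
  have := isProbabilityMeasure_tilt hφ hp
  set Q := Measure.infinitePi fun _ : ℕ => tilt φ p with hQ
  have h1 : ∀ i, Tendsto (fun n => Q {ω | ENNReal.ofReal η ≤
      edist (empMean (φ i) n ω) (tiltMoment φ p i)}) atTop (𝓝 0) := fun i =>
    tendstoInMeasure_of_tendsto_ae
      (fun n => (measurable_empMean hφ i n).aestronglyMeasurable)
      (tendsto_empMean_ae hφ hp (hi i)) _ (ENNReal.ofReal_pos.2 hη)
  have h2 := tendsto_finsetSum (Finset.univ : Finset (Fin (m + 1))) fun i _ => h1 i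
  rw [Finset.sum_const_zero] at h2
  filter_upwards [h2.eventually_lt_const (show (0 : ℝ≥0∞) < 1 / 2 by simp)] with n hn
  have hcompl : (constraint φ (tiltMoment φ p) n η)ᶜ ⊆ ⋃ i ∈ (Finset.univ : Finset (Fin (m + 1))),
      {ω | ENNReal.ofReal η ≤ edist (empMean (φ i) n ω) (tiltMoment φ p i)} := by
    intro ω hω
    simp only [constraint, Set.mem_compl_iff, Set.mem_ofPred_eq, not_forall, not_le] at hω
    obtain ⟨i, hi⟩ := hω
    simp only [Set.mem_iUnion, Finset.mem_univ, exists_true_left]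
    refine ⟨i, ?_⟩
    rw [Set.mem_ofPred_eq, edist_dist]
    exact ENNReal.ofReal_le_ofReal hi.le
  have h3 : Q (constraint φ (tiltMoment φ p) n η)ᶜ < 1 / 2 :=
    ((measure_mono hcompl).trans (measure_biUnion_finset_le _ _)).trans_lt hn
  have h4 : 1 / 2 ≤ Q (constraint φ (tiltMoment φ p) n η) := by
    by_contra h
    have h5 := prob_add_prob_compl (μ := Q) (measurableSet_constraint hφ (tiltMoment φ p) n η)
    have h6 := ENNReal.add_lt_add (not_le.1 h) h3
    rw [h5, ENNReal.add_halves] at h6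
    exact lt_irrefl _ h6
  -- The event involves only the first `n` coordinates, on which the full product and the prefix
  -- measure agree.
  refine h4.trans_eq ?_
  have hr : Measurable fun (ω : ℕ → PosReal) (k : Fin n) => ω k :=
    measurable_pi_lambda _ fun k => measurable_pi_apply _
  have hmaps : Q.map (fun ω (k : Fin n) => ω k) =
      (prefixMeasure (refLaw φ) (tilt φ p) n).map fun ω (k : Fin n) => ω k := by
    rw [hQ, infinitePi_map_comp_fintype _ Fin.val_injective,
      prefixMeasure_map _ _ Fin.val_injective fun k => k.2]
  have hpre : constraint φ (tiltMoment φ p) n η = (fun (ω : ℕ → PosReal) (k : Fin n) => ω k) ⁻¹'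
      {x | ∀ i, |(∑ k, φ i (x k)) / n - tiltMoment φ p i| ≤ η} := by
    ext ω
    simp only [constraint, empMean, Set.mem_ofPred_eq, Set.mem_preimage]
    simp_rw [Finset.sum_range fun l => φ _ (ω l)]
  have hm : MeasurableSet {x : Fin n → PosReal |
      ∀ i, |(∑ k, φ i (x k)) / n - tiltMoment φ p i| ≤ η} := by
    rw [Set.ofPred_forall]
    exact MeasurableSet.iInter fun i => measurableSet_le
      (((Finset.measurable_fun_sum _ fun k _ => (measurable_obs hφ i).comp
        (measurable_pi_apply k)).div_const _).sub_const _).norm measurable_const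
  rw [hpre, ← Measure.map_apply hr hm, hmaps, Measure.map_apply hr hm]

/-- The reverse change of measure. The centre `v` is free: it will be the vector of moments of the
tilted law, where the law of large numbers bounds the left side below. -/
theorem constraint_ge (hφ : Observables φ) {p : Fin (m + 1) → ℝ} (hp : Normalizable φ p)
    (v : Fin (m + 1) → ℝ) (n : ℕ) (η : ℝ) :
    prefixMeasure (refLaw φ) (tilt φ p) n (constraint φ v n η) ≤
      ENNReal.ofReal (Real.exp (n * (∑ i, p i * v i + η * l1 p - Real.log (partition φ p)))) *
        refMeasure φ (constraint φ v n η) := by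
  have hC := measurableSet_constraint hφ v n η
  rw [prefixMeasure_tilt hφ hp, withDensity_apply _ hC, ← setLIntegral_const]
  refine setLIntegral_mono' hC fun ω hω => ENNReal.ofReal_le_ofReal (Real.exp_le_exp.2 ?_)
  have h1 := (abs_le.1 (abs_sum_sub_le (p := p) hω)).2
  refine mul_le_mul_of_nonneg_left ?_ n.cast_nonneg
  linarith

/-- Independence of the first `n` coordinates and the following one. -/
theorem refMeasure_constraint_inter (hφ : Observables φ) (v : Fin (m + 1) → ℝ) (n : ℕ) (η : ℝ)
    {J : Set PosReal} (hJ : MeasurableSet J) :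
    refMeasure φ (constraint φ v n η ∩ {ω | ω n ∈ J}) =
      refMeasure φ (constraint φ v n η) * refLaw φ J := by
  have := isProbabilityMeasure_refLaw hφ
  have hind := (iIndepFun_infinitePi (P := fun _ : ℕ => refLaw φ)
    (X := fun _ (x : PosReal) => x) fun _ => measurable_id).indepFun_finset
    (Finset.range n) {n} (by simp) fun i => measurable_pi_apply i
  have hA : MeasurableSet {x : Finset.range n → PosReal |
      ∀ i, |(∑ k, φ i (x k)) / n - v i| ≤ η} := by
    rw [Set.ofPred_forall]
    exact MeasurableSet.iInter fun i => measurableSet_le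
      (((Finset.measurable_fun_sum _ fun k _ => (measurable_obs hφ i).comp
        (measurable_pi_apply k)).div_const _).sub_const _).norm measurable_const
  have hB : MeasurableSet {x : ({n} : Finset ℕ) → PosReal | x ⟨n, by simp⟩ ∈ J} :=
    measurable_pi_apply _ hJ
  have h1 := hind.measure_inter_preimage_eq_mul _ _ hA hB
  have hpre : (fun (ω : ℕ → PosReal) (k : Finset.range n) => ω k) ⁻¹'
      {x | ∀ i, |(∑ k, φ i (x k)) / n - v i| ≤ η} = constraint φ v n η := by
    ext ω
    simp only [constraint, empMean, Set.mem_ofPred_eq, Set.mem_preimage]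
    refine forall_congr' fun i => ?_
    rw [← Finset.sum_coe_sort (Finset.range n) fun l => φ i (ω l)]
  rw [hpre] at h1
  refine h1.trans ?_
  congr 1
  have h2 := Measure.infinitePi_map_eval (fun _ : ℕ => refLaw φ) n
  conv_rhs => rw [← h2]
  rw [Measure.map_apply (measurable_pi_apply n) hJ]
  rfl

theorem empMean_succ (f : ℝ → ℝ) (n : ℕ) (ω : ℕ → PosReal) :
    (n + 1 : ℝ) * empMean f (n + 1) ω = n * empMean f n ω + f (ω n) := by
  have h := mul_empMean (f := f) n.succ_ne_zero ω
  push_cast at h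
  rw [h, Finset.sum_range_succ]
  rcases eq_or_ne n 0 with rfl | hn
  · simp
  · rw [mul_empMean hn]

/-- One large coordinate adjusts the last empirical mean without affecting the other ones. -/
theorem eventually_inter_subset_constraint (hφ : Observables φ) {a v : Fin (m + 1) → ℝ}
    {δ δ' η : ℝ} (hη : 0 < η) (hδ' : 0 ≤ δ') (hδ : δ' + 4 * η ≤ δ)
    (hv : ∀ i : Fin m, |v i.castSucc - a i.castSucc| ≤ δ')
    (hlast : v (Fin.last m) ≤ a (Fin.last m) + δ') (ha : 0 ≤ a (Fin.last m)) :
    ∀ᶠ n : ℕ in atTop, constraint φ v n η ∩ {ω | ω n ∈ {x : PosReal |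
        (max 0 (a (Fin.last m) - v (Fin.last m)) + η) * n ≤ φ (Fin.last m) x ∧
        φ (Fin.last m) x ≤ (max 0 (a (Fin.last m) - v (Fin.last m)) + 2 * η) * n}} ⊆
      constraint φ a (n + 1) δ := by
  set c := max 0 (a (Fin.last m) - v (Fin.last m)) with hc
  have hc0 : 0 ≤ c := le_max_left _ _
  -- With this ratio, a coordinate whose last observable is at most `(c + 2 * η) * n` contributes at
  -- most `η * n + K i` to the other sums.
  choose K hK0 hK using fun i : Fin m =>
    obs_le_mul_add hφ (Fin.castSucc_lt_last i) (ε := η / (c + 2 * η)) (by positivity)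
  have hbig : ∀ x : ℝ, ∀ᶠ n : ℕ in atTop, x ≤ n := fun x =>
    tendsto_natCast_atTop_atTop.eventually_ge_atTop x
  have hδ0 : 0 < δ := by linarith
  filter_upwards [eventually_all.2 fun i => hbig ((K i + |a i.castSucc|) / (2 * η)),
    hbig (a (Fin.last m) / δ)] with n hn1 hn2
  rintro ω ⟨hω, hJ1, hJ2⟩ i
  have hn0 : (0 : ℝ) ≤ n := n.cast_nonneg
  have hn : (0 : ℝ) < n + 1 := by positivity
  have hS := abs_le.1 (hω i)
  have hsucc := empMean_succ (φ i) n ω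
  suffices |(n + 1 : ℝ) * (empMean (φ i) (n + 1) ω - a i)| ≤ (n + 1) * δ by
    rw [abs_mul, abs_of_pos hn] at this
    exact le_of_mul_le_mul_left this hn
  rw [mul_sub, hsucc]
  have hy := hφ.pos i (ω n) (ω n).2
  have hm1 := mul_le_mul_of_nonneg_left hS.1 hn0
  have hm2 := mul_le_mul_of_nonneg_left hS.2 hn0
  induction i using Fin.lastCases with
  | last =>
    have h1 : a (Fin.last m) ≤ v (Fin.last m) + c := by
      linarith [le_max_right 0 (a (Fin.last m) - v (Fin.last m))]
    have h2 : v (Fin.last m) + c ≤ a (Fin.last m) + δ' := by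
      rw [hc, ← le_sub_iff_add_le']
      exact max_le (by linarith) (by linarith)
    have h3 := mul_le_mul_of_nonneg_left h1 hn0
    have h4 := mul_le_mul_of_nonneg_left h2 hn0
    have h5 := mul_le_mul_of_nonneg_left hδ hn0
    have h6 : 0 ≤ n * η := by positivity
    rw [div_le_iff₀ hδ0] at hn2
    rw [abs_le]
    constructor <;> nlinarith
  | cast i =>
    have h1 := hn1 i
    rw [div_le_iff₀ (by positivity)] at h1
    have h2 : φ i.castSucc (ω n) ≤ η * n + K i := by
      refine (hK i _ (ω n).2).trans ?_
      refine add_le_add ?_ le_rfl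
      calc η / (c + 2 * η) * φ (Fin.last m) (ω n) ≤ η / (c + 2 * η) * ((c + 2 * η) * n) := by
            gcongr
        _ = η * n := by
          have : c + 2 * η ≠ 0 := by positivity
          field_simp
    have h3 := abs_le.1 (hv i)
    have h4 := mul_le_mul_of_nonneg_left h3.1 hn0
    have h5 := mul_le_mul_of_nonneg_left h3.2 hn0
    have h6 := mul_le_mul_of_nonneg_left hδ hn0
    have h7 : 0 ≤ n * η := by positivity
    have h8 := neg_abs_le (a i.castSucc)
    have h9 := le_abs_self (a i.castSucc)
    rw [abs_le]
    constructor <;> nlinarith [hK0 i]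

/-- A gap in the rate pays both for the factor `1 / 2` from the law of large numbers and for the
additional coordinate. -/
theorem eventually_le_half_exp {x y : ℝ} (h : x < y) :
    ∀ᶠ n : ℕ in atTop, Real.exp ((n + 1 : ℝ) * x) ≤ 1 / 2 * Real.exp (n * y) := by
  have h1 : Tendsto (fun n : ℕ => (n : ℝ) * (y - x)) atTop atTop :=
    tendsto_natCast_atTop_atTop.atTop_mul_const (sub_pos.2 h)
  filter_upwards [h1.eventually_ge_atTop (x + Real.log 2)] with n hn
  have : (1 : ℝ) / 2 = Real.exp (-Real.log 2) := by
    rw [Real.exp_neg, Real.exp_log two_pos, one_div]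
  rw [this, ← Real.exp_add, Real.exp_le_exp]
  linarith

/-- The probability of the constraint decays at most at the rate given by the dual problem. -/
theorem eventually_constraint_ge (hm : 1 ≤ m) (hφ : Observables φ)
    (hg : ContinuousOn (g₁ φ) (A₁ φ)) {a : Fin (m + 1) → ℝ} (ha : a ∈ admissible φ) {δ : ℝ}
    (hδ : 0 < δ) {p : Fin (m + 1) → ℝ} (hp : IsOptimal φ a δ p) {ε : ℝ} (hε : 0 < ε) :
    ∀ᶠ n : ℕ in atTop, ENNReal.ofReal (Real.exp (n * (dualObjective φ a δ p - ε))) ≤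
      refMeasure φ (constraint φ a n δ) := by
  obtain ⟨c, hc, K, hK, hcoer⟩ := exists_coercive hφ hg ha
  set R := K / c with hR
  have hR0 : 0 ≤ R := by positivity
  -- The narrower width `δ - τ` leaves room for four errors of size `τ / 4`. Since `R` bounds the
  -- optimizers of all widths, `τ` can be chosen before `q` so that changing the width costs at most
  -- a fraction of `ε` in the rate.
  set τ := min δ (ε / (4 * (R + 1))) with hτ
  have hτ0 : 0 < τ := lt_min hδ (by positivity)
  have hτR : τ * R ≤ ε / 4 := by
    have h1 : τ * (4 * (R + 1)) ≤ ε := (le_div_iff₀ (by positivity)).1 (min_le_right _ _)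
    nlinarith
  have hδ' : 0 ≤ δ - τ := sub_nonneg.2 (min_le_left _ _)
  obtain ⟨q, hq⟩ := exists_isOptimal hm hφ hg ha hδ'
  have hqR : l1 q ≤ R := by
    rw [hR, le_div_iff₀ hc, mul_comm]
    exact hq.mul_l1_le hφ hδ' hcoer
  set V := dualObjective φ a δ p with hV
  have hVq : V ≤ Real.log (partition φ q) - ∑ i, q i * a i + δ * l1 q :=
    hp.objective_le hφ hq.normalizable hq.last_nonpos
  set v := tiltMoment φ q with hv
  have hη : 0 < τ / 4 := by positivity
  have hrate : ∑ i, q i * v i + τ / 4 * l1 q - Real.log (partition φ q) ≤ -V + ε / 2 := by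
    have h1 := hq.slack
    simp only [mul_sub, Finset.sum_sub_distrib] at h1
    have h2 := mul_le_mul_of_nonneg_left hqR hτ0.le
    linarith
  have hlast : 0 ≤ a (Fin.last m) := by
    by_contra h
    have h1 := ha.2
    rw [proj₂, ENNReal.ofReal_of_nonpos (not_le.1 h).le] at h1
    exact not_lt_zero h1
  set b := max 0 (a (Fin.last m) - v (Fin.last m)) with hb
  have hb0 : 0 ≤ b := le_max_left _ _
  have hJ := tendsto_natCast_atTop_atTop.eventually (refLaw_window_ge hm hφ
    (α := b + τ / 4) (β := b + 2 * (τ / 4)) (η := ε / 4) (by positivity) (by linarith)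
    (by positivity))
  have hsub := eventually_inter_subset_constraint hφ hη hδ' (δ := δ) (by linarith)
    hq.abs_sub_le hq.last_le hlast
  have hlln := eventually_half_le_constraint hφ hq.normalizable hq.integrable hη
  have hexp := eventually_le_half_exp (show V - ε < V - 3 * ε / 4 by linarith)
  -- Budget for `ε`: one half for the tilting, one quarter for the large coordinate, one quarter for
  -- the factor `1 / 2` and the passage from `n` to `n + 1`.
  have hmain : ∀ᶠ n : ℕ in atTop, ENNReal.ofReal (Real.exp (((n + 1 : ℕ) : ℝ) * (V - ε))) ≤
      refMeasure φ (constraint φ a (n + 1) δ) := by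
    filter_upwards [hJ, hsub, hlln, hexp] with n hJ hsub hlln hexp
    have h1 := hlln.trans (constraint_ge hφ hq.normalizable v n (τ / 4))
    have h2 : ENNReal.ofReal (1 / 2 * Real.exp (n * (V - ε / 2))) ≤
        refMeasure φ (constraint φ v n (τ / 4)) := by
      have h3 : (1 / 2 : ℝ≥0∞) ≤ ENNReal.ofReal (Real.exp (n * (-V + ε / 2))) *
          refMeasure φ (constraint φ v n (τ / 4)) := by
        refine h1.trans ?_
        gcongr
      calc ENNReal.ofReal (1 / 2 * Real.exp (n * (V - ε / 2)))
          = ENNReal.ofReal (Real.exp (n * (V - ε / 2))) * (1 / 2) := by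
            rw [mul_comm, ENNReal.ofReal_mul (Real.exp_pos _).le]
            congr 1
            rw [ENNReal.ofReal_div_of_pos two_pos]
            simp
        _ ≤ ENNReal.ofReal (Real.exp (n * (V - ε / 2))) *
            (ENNReal.ofReal (Real.exp (n * (-V + ε / 2))) *
              refMeasure φ (constraint φ v n (τ / 4))) := by gcongr
        _ = _ := by
            rw [← mul_assoc, ← ENNReal.ofReal_mul (Real.exp_pos _).le, ← Real.exp_add]
            ring_nf
            simp
    have hJm : MeasurableSet {x : PosReal | (b + τ / 4) * n ≤ φ (Fin.last m) x ∧
        φ (Fin.last m) x ≤ (b + 2 * (τ / 4)) * n} :=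
      (measurableSet_le measurable_const (measurable_obs hφ _)).inter
        (measurableSet_le (measurable_obs hφ _) measurable_const)
    calc ENNReal.ofReal (Real.exp (((n + 1 : ℕ) : ℝ) * (V - ε)))
        ≤ ENNReal.ofReal (1 / 2 * Real.exp (n * (V - 3 * ε / 4))) := by
          push_cast
          exact ENNReal.ofReal_le_ofReal hexp
      _ = ENNReal.ofReal (1 / 2 * Real.exp (n * (V - ε / 2))) *
            ENNReal.ofReal (Real.exp (-(ε / 4) * n)) := by
          rw [← ENNReal.ofReal_mul (by positivity), mul_assoc, ← Real.exp_add]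
          ring_nf
      _ ≤ refMeasure φ (constraint φ v n (τ / 4)) * refLaw φ {x : PosReal |
            (b + τ / 4) * n ≤ φ (Fin.last m) x ∧
            φ (Fin.last m) x ≤ (b + 2 * (τ / 4)) * n} := mul_le_mul' h2 hJ
      _ = _ := (refMeasure_constraint_inter hφ v n (τ / 4) hJm).symm
      _ ≤ _ := measure_mono hsub
  obtain ⟨N, hN⟩ := eventually_atTop.1 hmain
  refine eventually_atTop.2 ⟨N + 1, fun n hn => ?_⟩
  obtain ⟨k, rfl⟩ := Nat.exists_eq_add_of_le' (show 1 ≤ n by omega)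
  exact hN k (by omega)

/-! ### The conditional limit theorem at fixed width. -/

theorem integral_exp_mul_le {E : Type*} [MeasurableSpace E] (ν : Measure E)
    [IsProbabilityMeasure ν] {f : E → ℝ} (hf : Measurable f) {B : ℝ} (hB : ∀ x, |f x| ≤ B)
    {t : ℝ} (ht : 0 ≤ t) (htB : t * B ≤ 1) :
    ∫ x, Real.exp (t * f x) ∂ν ≤ Real.exp (t * ∫ x, f x ∂ν + t ^ 2 * B ^ 2) := by
  have hfi : Integrable f ν := Integrable.of_bound hf.aestronglyMeasurable B (ae_of_all _ hB)
  -- Second-order expansion, valid since `|t * f x| ≤ 1`. After division by `t` the error is `t * B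
  -- ^ 2`, which a small `t` makes negligible.
  have hbound : ∀ x, Real.exp (t * f x) ≤ 1 + t * f x + t ^ 2 * B ^ 2 := by
    intro x
    have h1 : |t * f x| ≤ t * B := by
      rw [abs_mul, abs_of_nonneg ht]
      exact mul_le_mul_of_nonneg_left (hB x) ht
    have h2 := (abs_le.1 (Real.abs_exp_sub_one_sub_id_le (h1.trans htB))).2
    have h3 : (t * f x) ^ 2 ≤ (t * B) ^ 2 := sq_le_sq' (by linarith [abs_le.1 h1]) (abs_le.1 h1).2
    nlinarith
  have i1 : Integrable (fun x => 1 + t * f x) ν := (integrable_const 1).add (hfi.const_mul t)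
  have i2 : Integrable (fun x => 1 + t * f x + t ^ 2 * B ^ 2) ν := i1.add (integrable_const _)
  have i3 : Integrable (fun x => Real.exp (t * f x)) ν := i2.mono'
    (hf.const_mul t).exp.aestronglyMeasurable (ae_of_all _ fun x => by
      rw [Real.norm_of_nonneg (Real.exp_pos _).le]; exact hbound x)
  calc ∫ x, Real.exp (t * f x) ∂ν ≤ ∫ x, (1 + t * f x + t ^ 2 * B ^ 2) ∂ν :=
        integral_mono i3 i2 hbound
    _ = (t * ∫ x, f x ∂ν + t ^ 2 * B ^ 2) + 1 := by
        rw [integral_add i1 (integrable_const _), integral_add (integrable_const _)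
          (hfi.const_mul t), integral_const_mul]
        simp
        ring
    _ ≤ _ := Real.add_one_le_exp _

theorem tendsto_of_forall_eventually_le {ι : Type*} {l : Filter ι} {I : ι → ℝ} {M : ℝ}
    (h1 : ∀ η > 0, ∀ᶠ x in l, I x ≤ M + η) (h2 : ∀ η > 0, ∀ᶠ x in l, -I x ≤ -M + η) :
    Tendsto I l (𝓝 M) := by
  rw [Metric.tendsto_nhds]
  intro ε hε
  filter_upwards [h1 (ε / 2) (by positivity), h2 (ε / 2) (by positivity)] with x hx1 hx2
  rw [Real.dist_eq, abs_lt]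
  constructor <;> linarith

theorem blockSwap_mem_range {j n b : ℕ} (hb : b < n / j) {i : ℕ} (hi : i ∈ Finset.range n) :
    blockSwap j b i ∈ Finset.range n := by
  have h1 : (b + 1) * j ≤ n := (Nat.mul_le_mul_right j hb).trans (Nat.div_mul_le_self n j)
  rw [Nat.add_mul] at h1
  simp only [Finset.mem_range, blockSwap] at *
  split_ifs <;> omega

theorem empMean_blockSwap (f : ℝ → ℝ) {j n b : ℕ} (hb : b < n / j) (ω : ℕ → PosReal) :
    empMean f n (fun i => ω (blockSwap j b i)) = empMean f n ω := by
  rw [empMean, empMean]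
  congr 1
  exact Finset.sum_nbij' (blockSwap j b) (blockSwap j b) (fun i hi => blockSwap_mem_range hb hi)
    (fun i hi => blockSwap_mem_range hb hi) (fun i _ => blockSwap_involutive i)
    (fun i _ => blockSwap_involutive i) fun i _ => rfl

/-- Exchangeability of the conditioned measure: all blocks have the same law. -/
theorem integral_cond_block (hφ : Observables φ) (a : Fin (m + 1) → ℝ) (δ : ℝ) {j n b : ℕ}
    (hb : b < n / j) {f : (Fin j → PosReal) → ℝ} (hf : Measurable f) :
    ∫ ω, f (fun l => ω (blockIndex j b l)) ∂cond (refMeasure φ) (constraint φ a n δ) =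
      ∫ ω, f (fun l => ω l) ∂cond (refMeasure φ) (constraint φ a n δ) := by
  have := isProbabilityMeasure_refLaw hφ
  set T : (ℕ → PosReal) → (ℕ → PosReal) := fun ω i => ω (blockSwap j b i) with hT
  have hTm : Measurable T := measurable_pi_lambda _ fun i => measurable_pi_apply _
  have hpres : MeasurePreserving T (refMeasure φ) (refMeasure φ) :=
    ⟨hTm, infinitePi_map_comp (fun _ => refLaw φ) blockSwap_involutive.injective⟩
  have hC : T ⁻¹' constraint φ a n δ = constraint φ a n δ := by
    ext ω
    simp only [constraint, Set.mem_preimage, Set.mem_ofPred_eq, hT, empMean_blockSwap _ hb]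
  have h1 := hpres.restrict_preimage (measurableSet_constraint hφ a n δ)
  rw [hC] at h1
  have h2 : (cond (refMeasure φ) (constraint φ a n δ)).map T =
      cond (refMeasure φ) (constraint φ a n δ) := by
    rw [ProbabilityTheory.cond, Measure.map_smul, h1.map_eq]
  conv_rhs => rw [← h2]
  have hfm : Measurable fun ω : ℕ → PosReal => f fun l : Fin j => ω l :=
    hf.comp (measurable_pi_lambda _ fun l => measurable_pi_apply _)
  rw [integral_map hTm.aemeasurable hfm.aestronglyMeasurable]
  simp only [hT, blockSwap, Fin.is_lt, if_true, blockIndex]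

/-- One-sided conditional limit theorem. -/
theorem eventually_integral_marginal_le (hm : 1 ≤ m) (hφ : Observables φ)
    (hg : ContinuousOn (g₁ φ) (A₁ φ)) {a : Fin (m + 1) → ℝ} (ha : a ∈ admissible φ) {δ : ℝ}
    (hδ : 0 < δ) {p : Fin (m + 1) → ℝ} (hp : IsOptimal φ a δ p) {j : ℕ} (hj : 0 < j)
    (f : (Fin j → PosReal) →ᵇ ℝ) {η : ℝ} (hη : 0 < η) :
    ∀ᶠ n : ℕ in atTop, ∫ x, f x ∂marginal φ a j n δ ≤
      ∫ x, f x ∂(Measure.pi fun _ : Fin j => tilt φ p) + η := by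
  have := isProbabilityMeasure_refLaw hφ
  have := isProbabilityMeasure_tilt hφ hp.normalizable
  have hfm : Measurable f := f.continuous.measurable
  set B := ‖f‖ + 1 with hB
  have hB0 : 0 < B := by positivity
  have hfB : ∀ x, |f x| ≤ B := fun x => (f.norm_coe_le_norm x).trans (by linarith)
  -- The first bound allows the expansion of the exponential, and the second makes its error at most
  -- `η / 2`.
  set t := min (1 / B) (η / (2 * B ^ 2)) with ht
  have ht0 : 0 < t := lt_min (by positivity) (by positivity)
  have htB : t * B ≤ 1 := (le_div_iff₀ hB0).1 (min_le_left _ _)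
  have htB2 : t * B ^ 2 ≤ η / 2 := by
    have := (le_div_iff₀ (by positivity)).1 (min_le_right (1 / B) (η / (2 * B ^ 2)))
    linarith
  have hj0 : (0 : ℝ) < j := by exact_mod_cast hj
  -- Since `n ≤ 2 * N * j` for the number `N` of blocks, a loss `n * ε` in the rate costs at most `N
  -- * (η * t / 2)`.
  set ε := η * t / (4 * j) with hε
  have hε0 : 0 < ε := by positivity
  set V := dualObjective φ a δ p
  set M := ∫ x, f x ∂(Measure.pi fun _ : Fin j => tilt φ p) with hM
  filter_upwards [eventually_constraint_ge hm hφ hg ha hδ hp hε0, eventually_ge_atTop j]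
    with n hlow hn
  set C := constraint φ a n δ
  have hCm : MeasurableSet C := measurableSet_constraint hφ a n δ
  have hPinst : IsProbabilityMeasure (refMeasure φ) := by unfold refMeasure; infer_instance
  have hC0 : refMeasure φ C ≠ 0 := fun h => by
    rw [h, nonpos_iff_eq_zero, ENNReal.ofReal_eq_zero] at hlow
    exact absurd (Real.exp_pos _) (not_lt.2 hlow)
  set μ := cond (refMeasure φ) C with hμ
  have : IsProbabilityMeasure μ := cond_isProbabilityMeasure hC0
  set N := n / j with hN
  have hN1 : 1 ≤ N := (Nat.one_le_div_iff hj).2 hn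
  have hnN : (n : ℝ) ≤ 2 * N * j := by
    have h1 : n < (N + 1) * j := Nat.lt_mul_of_div_lt (Nat.lt_succ_self _) hj
    have h2 : n ≤ 2 * N * j := h1.le.trans (Nat.mul_le_mul_right j (by omega))
    exact_mod_cast h2
  have hYm : ∀ b, Measurable fun (ω : ℕ → PosReal) (l : Fin j) => ω (blockIndex j b l) :=
    fun b => measurable_pi_lambda _ fun l => measurable_pi_apply _
  set I := ∫ ω, f (fun l : Fin j => ω l) ∂μ with hI
  have hmarg : ∫ x, f x ∂marginal φ a j n δ = I := by
    have hrm : Measurable fun (ω : ℕ → PosReal) (l : Fin j) => ω l :=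
      measurable_pi_lambda _ fun l => measurable_pi_apply _
    rw [marginal, integral_map hrm.aemeasurable hfm.aestronglyMeasurable]
  -- Under the conditioned law every block has the law of the first one, so `X` has mean `N * (t *
  -- I)`. Jensen's inequality then bounds `I` by an exponential moment, which factorizes over blocks
  -- under the tilted law.
  set X : (ℕ → PosReal) → ℝ := fun ω =>
    ∑ b ∈ Finset.range N, t * f (fun l => ω (blockIndex j b l)) with hX
  have hXm : Measurable X := Finset.measurable_fun_sum _ fun b _ =>
    (hfm.comp (hYm b)).const_mul t
  have hfi : ∀ b ∈ Finset.range N,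
      Integrable (fun ω : ℕ → PosReal => t * f (fun l => ω (blockIndex j b l))) μ := fun b _ =>
    (Integrable.of_bound (hfm.comp (hYm b)).aestronglyMeasurable B
      (ae_of_all _ fun ω => hfB _)).const_mul t
  have hXi : Integrable X μ := integrable_finsetSum _ hfi
  have hXb : ∀ ω, X ω ≤ N * (t * B) := by
    intro ω
    refine (Finset.sum_le_card_nsmul _ _ (t * B) fun b _ => ?_).trans_eq (by simp)
    exact mul_le_mul_of_nonneg_left ((le_abs_self _).trans (hfB _)) ht0.le
  have hXe : Integrable (fun ω => Real.exp (X ω)) μ :=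
    Integrable.of_bound hXm.exp.aestronglyMeasurable (Real.exp (N * (t * B)))
      (ae_of_all _ fun ω => by
        rw [Real.norm_of_nonneg (Real.exp_pos _).le]; exact Real.exp_le_exp.2 (hXb ω))
  have hXI : ∫ ω, X ω ∂μ = N * (t * I) := by
    simp only [hX]
    rw [integral_finsetSum _ hfi]
    simp_rw [integral_const_mul]
    rw [Finset.sum_congr rfl fun b hb => congrArg (t * ·)
      (integral_cond_block hφ a δ (Finset.mem_range.1 hb) hfm), Finset.sum_const,
      Finset.card_range, nsmul_eq_mul]
  have hjensen := exp_integral_le hXi hXe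
  rw [hXI] at hjensen
  set F : (Fin j → PosReal) → ℝ≥0∞ := fun x => ENNReal.ofReal (Real.exp (t * f x)) with hF
  have hFm : Measurable F := (hfm.const_mul t).exp.ennreal_ofReal
  have hFint : ∫⁻ x, F x ∂(Measure.pi fun _ : Fin j => tilt φ p) ≤
      ENNReal.ofReal (Real.exp (t * M + t ^ 2 * B ^ 2)) := by
    have hi : Integrable (fun x => Real.exp (t * f x)) (Measure.pi fun _ : Fin j => tilt φ p) :=
      Integrable.of_bound (hfm.const_mul t).exp.aestronglyMeasurable (Real.exp (t * B))
        (ae_of_all _ fun x => by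
          rw [Real.norm_of_nonneg (Real.exp_pos _).le]
          exact Real.exp_le_exp.2
            (mul_le_mul_of_nonneg_left ((le_abs_self _).trans (hfB x)) ht0.le))
    simp only [hF]
    rw [← ofReal_integral_eq_lintegral_ofReal hi (ae_of_all _ fun x => (Real.exp_pos _).le)]
    exact ENNReal.ofReal_le_ofReal (integral_exp_mul_le _ hfm hfB ht0.le htB)
  have hXF : ∀ ω, ENNReal.ofReal (Real.exp (X ω)) =
      ∏ b ∈ Finset.range N, F (fun l => ω (blockIndex j b l)) := by
    intro ω
    simp only [hX, hF]
    rw [Real.exp_sum, ENNReal.ofReal_prod_of_nonneg fun _ _ => (Real.exp_pos _).le]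
  have hupper : ∫⁻ ω in C, ENNReal.ofReal (Real.exp (X ω)) ∂refMeasure φ ≤
      ENNReal.ofReal (Real.exp (n * V + N * (t * M + t ^ 2 * B ^ 2))) := by
    refine (setLIntegral_constraint_le hφ hp.normalizable a n δ hXm.exp.ennreal_ofReal).trans ?_
    simp_rw [hXF]
    rw [lintegral_prod_blocks _ _ hFm, Real.exp_add, ENNReal.ofReal_mul (Real.exp_pos _).le,
      Real.exp_nat_mul (t * M + t ^ 2 * B ^ 2) N, ENNReal.ofReal_pow (Real.exp_pos _).le]
    gcongr
  have hcond : ENNReal.ofReal (Real.exp (N * (t * I))) * refMeasure φ C ≤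
      ENNReal.ofReal (Real.exp (n * V + N * (t * M + t ^ 2 * B ^ 2))) := by
    refine le_trans ?_ hupper
    have h1 : ENNReal.ofReal (∫ ω, Real.exp (X ω) ∂μ) =
        (refMeasure φ C)⁻¹ * ∫⁻ ω in C, ENNReal.ofReal (Real.exp (X ω)) ∂refMeasure φ := by
      rw [ofReal_integral_eq_lintegral_ofReal hXe (ae_of_all _ fun x => (Real.exp_pos _).le), hμ,
        ProbabilityTheory.cond, lintegral_smul_measure, smul_eq_mul]
    calc ENNReal.ofReal (Real.exp (N * (t * I))) * refMeasure φ C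
        ≤ ENNReal.ofReal (∫ ω, Real.exp (X ω) ∂μ) * refMeasure φ C := by gcongr
      _ = ((refMeasure φ C)⁻¹ * refMeasure φ C) *
          ∫⁻ ω in C, ENNReal.ofReal (Real.exp (X ω)) ∂refMeasure φ := by rw [h1]; ring
      _ = _ := by rw [ENNReal.inv_mul_cancel hC0 (measure_ne_top _ _), one_mul]
  have hfinal : N * (t * I) + n * (V - ε) ≤ n * V + N * (t * M + t ^ 2 * B ^ 2) := by
    have h1 := (mul_le_mul_right hlow (ENNReal.ofReal (Real.exp (N * (t * I))))).trans hcond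
    rw [← ENNReal.ofReal_mul (Real.exp_pos _).le, ← Real.exp_add,
      ENNReal.ofReal_le_ofReal_iff (Real.exp_pos _).le, Real.exp_le_exp] at h1
    exact h1
  have hN0 : (0 : ℝ) < N := by exact_mod_cast hN1
  have hjε : j * ε = η * t / 4 := by rw [hε]; field_simp
  have h2 : n * ε ≤ N * (η * t / 2) :=
    calc n * ε ≤ (2 * N * j) * ε := by gcongr
      _ = N * (2 * (j * ε)) := by ring
      _ = _ := by rw [hjε]; ring
  have h3 : t * (t * B ^ 2) ≤ t * (η / 2) := mul_le_mul_of_nonneg_left htB2 ht0.le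
  have h4 : N * (t * I) ≤ N * (t * (M + η)) := by
    have := mul_le_mul_of_nonneg_left h3 hN0.le
    nlinarith
  rw [hmarg]
  exact le_of_mul_le_mul_left (le_of_mul_le_mul_left h4 hN0) ht0

theorem tendsto_integral_marginal (hm : 1 ≤ m) (hφ : Observables φ)
    (hg : ContinuousOn (g₁ φ) (A₁ φ)) {a : Fin (m + 1) → ℝ} (ha : a ∈ admissible φ) {δ : ℝ}
    (hδ : 0 < δ) {p : Fin (m + 1) → ℝ} (hp : IsOptimal φ a δ p) {j : ℕ} (hj : 0 < j)
    (f : (Fin j → PosReal) →ᵇ ℝ) :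
    Tendsto (fun n => ∫ x, f x ∂marginal φ a j n δ) atTop
      (𝓝 (∫ x, f x ∂(Measure.pi fun _ : Fin j => tilt φ p))) := by
  refine tendsto_of_forall_eventually_le
    (fun η hη => eventually_integral_marginal_le hm hφ hg ha hδ hp hj f hη) fun η hη => ?_
  have h := eventually_integral_marginal_le hm hφ hg ha hδ hp hj (-f) hη
  simpa only [BoundedContinuousFunction.coe_neg, Pi.neg_apply, integral_neg] using h

/-! ### The limit of vanishing width. -/

/-- Stability of the tilted measure in the width of the constraint. -/
theorem integral_tilt_le (hφ : Observables φ) {a : Fin (m + 1) → ℝ} {δ : ℝ}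
    (hδ : 0 ≤ δ) {p p₀ : Fin (m + 1) → ℝ} (hp : IsOptimal φ a δ p) (hp₀ : IsOptimal φ a 0 p₀)
    (f : PosReal →ᵇ ℝ) {B : ℝ} (hfB : ∀ x, |f x| ≤ B) {t : ℝ} (ht : 0 < t) (htB : t * B ≤ 1) :
    ∫ x, f x ∂tilt φ p ≤ ∫ x, f x ∂tilt φ p₀ + t * B ^ 2 + δ * l1 p₀ / t := by
  have := isProbabilityMeasure_tilt hφ hp.normalizable
  have := isProbabilityMeasure_tilt hφ hp₀.normalizable
  have hZ := partition_pos hφ hp.normalizable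
  have hZ₀ := partition_pos hφ hp₀.normalizable
  have hfm : Measurable f := f.continuous.measurable
  have hfi : Integrable f (tilt φ p) :=
    Integrable.of_bound hfm.aestronglyMeasurable B (ae_of_all _ hfB)
  set k := Real.log (partition φ p) - Real.log (partition φ p₀) with hk
  -- The function `t * f` plus the log-density of `tilt φ p₀` with respect to `tilt φ p`. Jensen's
  -- inequality for `g` is the entropy inequality: `t` times the integral of `f` is at most a
  -- log-moment under `tilt φ p₀` plus the relative entropy of `tilt φ p`. The optimality of both
  -- parameters bounds this relative entropy by `δ * l1 p₀`.
  set g : PosReal → ℝ := fun x => t * f x + pairing φ (p₀ - p) x + k with hg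
  have hpi : Integrable (pairing φ (p₀ - p)) (tilt φ p) := integrable_pairing hp.integrable
  have i1 : Integrable (fun x => t * f x + pairing φ (p₀ - p) x) (tilt φ p) :=
    (hfi.const_mul t).add hpi
  have hgi : Integrable g (tilt φ p) := i1.add (integrable_const k)
  have e : (fun x => Real.exp ((pairing φ p + g) x)) =
      fun x => Real.exp (pairing φ p₀ x) * Real.exp (t * f x) * Real.exp k := by
    funext x
    rw [Pi.add_apply, hg, ← Real.exp_add, ← Real.exp_add]
    simp only [pairing_sub]
    ring_nf
  have i2 : Integrable (fun x => Real.exp (pairing φ p₀ x) * Real.exp (t * f x)) (refLaw φ) := by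
    refine hp₀.normalizable.mul_bdd (c := Real.exp (t * B))
      (hfm.const_mul t).exp.aestronglyMeasurable (ae_of_all _ fun x => ?_)
    rw [Real.norm_of_nonneg (Real.exp_pos _).le]
    exact Real.exp_le_exp.2 (mul_le_mul_of_nonneg_left ((le_abs_self _).trans (hfB x)) ht.le)
  have hei : Integrable (fun x => Real.exp (g x)) (tilt φ p) := by
    refine (integrable_tilted_iff hp.normalizable _).2 ?_
    simp_rw [smul_eq_mul, ← Real.exp_add]
    change Integrable (fun x => Real.exp ((pairing φ p + g) x)) _
    rw [e]
    exact i2.mul_const _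
  have heI : ∫ x, Real.exp (g x) ∂tilt φ p = ∫ x, Real.exp (t * f x) ∂tilt φ p₀ := by
    rw [tilt, integral_exp_tilted, e, integral_mul_const, tilt, integral_exp_tilted]
    change _ * Real.exp k / partition φ p = _ / partition φ p₀
    rw [hk, Real.exp_sub, Real.exp_log hZ, Real.exp_log hZ₀]
    simp_rw [Pi.add_apply, Real.exp_add]
    field_simp
  have hgI : ∫ x, g x ∂tilt φ p = t * ∫ x, f x ∂tilt φ p +
      ∑ i, (p₀ i - p i) * tiltMoment φ p i + k := by
    simp only [hg]
    rw [integral_add i1 (integrable_const k), integral_add (hfi.const_mul t) hpi,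
      integral_const_mul, integral_pairing hp.integrable, integral_const, probReal_univ, one_smul]
    rfl
  have h1 := (exp_integral_le hgi hei).trans
    (heI.le.trans (integral_exp_mul_le (tilt φ p₀) hfm hfB ht.le htB))
  rw [Real.exp_le_exp, hgI] at h1
  have h2 := hp₀.objective_le hφ hp.normalizable hp.last_nonpos
  have h3 := hp.neg_le_sum hp₀.last_nonpos
  have h4 := hp.slack
  simp only [mul_sub, sub_mul, Finset.sum_sub_distrib, zero_mul, add_zero] at h1 h2 h3 h4
  have h5 : 0 ≤ δ * l1 p := mul_nonneg hδ (l1_nonneg p)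
  have h6 : t * ∫ x, f x ∂tilt φ p ≤
      t * (∫ x, f x ∂tilt φ p₀ + t * B ^ 2 + δ * l1 p₀ / t) := by
    have : t * (δ * l1 p₀ / t) = δ * l1 p₀ := by field_simp
    rw [mul_add, mul_add, this]
    nlinarith
  exact le_of_mul_le_mul_left h6 ht

theorem eventually_integral_tilt_le (hφ : Observables φ) {a : Fin (m + 1) → ℝ}
    {p : ℝ → Fin (m + 1) → ℝ} (hp : ∀ δ, 0 < δ → IsOptimal φ a δ (p δ)) {p₀ : Fin (m + 1) → ℝ}
    (hp₀ : IsOptimal φ a 0 p₀) (f : PosReal →ᵇ ℝ) {η : ℝ} (hη : 0 < η) :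
    ∀ᶠ δ in 𝓝[>] (0 : ℝ), ∫ x, f x ∂tilt φ (p δ) ≤ ∫ x, f x ∂tilt φ p₀ + η := by
  set B := ‖f‖ + 1 with hB
  have hB0 : 0 < B := by positivity
  have hfB : ∀ x, |f x| ≤ B := fun x => (f.norm_coe_le_norm x).trans (by linarith)
  set t := min (1 / B) (η / (2 * B ^ 2)) with ht
  have ht0 : 0 < t := lt_min (by positivity) (by positivity)
  have htB : t * B ≤ 1 := (le_div_iff₀ hB0).1 (min_le_left _ _)
  have htB2 : t * B ^ 2 ≤ η / 2 := by
    have := (le_div_iff₀ (by positivity)).1 (min_le_right (1 / B) (η / (2 * B ^ 2)))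
    linarith
  have hlim : Tendsto (fun δ : ℝ => δ * l1 p₀ / t) (𝓝[>] 0) (𝓝 0) := by
    have : Continuous fun δ : ℝ => δ * l1 p₀ / t := by fun_prop
    simpa using (this.tendsto 0).mono_left nhdsWithin_le_nhds
  filter_upwards [hlim.eventually_lt_const (half_pos hη), self_mem_nhdsWithin] with δ h1 hδ
  have := integral_tilt_le hφ (le_of_lt hδ) (hp δ hδ) hp₀ f hfB ht0 htB
  linarith

/-- The law of one coordinate in the limit of exact constraints. -/
theorem hasIteratedWeakLimit_marginal (hm : 1 ≤ m) (hφ : Observables φ)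
    (hg : ContinuousOn (g₁ φ) (A₁ φ)) {a : Fin (m + 1) → ℝ} (ha : a ∈ admissible φ)
    {p₀ : Fin (m + 1) → ℝ} (hp₀ : IsOptimal φ a 0 p₀) {lam : ProbabilityMeasure PosReal}
    (hlam : (lam : Measure PosReal) = tilt φ p₀) {j : ℕ} (hj : 0 < j) :
    HasIteratedWeakLimit (fun n δ => marginal φ a j n δ)
      (ProbabilityMeasure.pi fun _ : Fin j => lam) := by
  -- The truncation `max 0 δ` only makes the choice total; it is `δ` for the widths that matter.
  choose p hp using fun δ : ℝ => exists_isOptimal hm hφ hg ha (le_max_left 0 δ)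
  have hp' : ∀ δ, 0 < δ → IsOptimal φ a δ (p δ) := fun δ hδ => by
    have := hp δ
    rwa [max_eq_right hδ.le] at this
  let Q : ℝ → ProbabilityMeasure PosReal := fun δ =>
    ⟨tilt φ (p δ), isProbabilityMeasure_tilt hφ (hp δ).normalizable⟩
  refine ⟨fun δ => ProbabilityMeasure.pi fun _ : Fin j => Q δ, ?_, ?_⟩
  · filter_upwards [self_mem_nhdsWithin] with δ hδ f
    exact tendsto_integral_marginal hm hφ hg ha hδ (hp' δ hδ) hj f
  · have hQ : Tendsto Q (𝓝[>] 0) (𝓝 lam) := by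
      rw [ProbabilityMeasure.tendsto_iff_forall_integral_tendsto]
      intro f
      rw [hlam]
      change Tendsto (fun δ => ∫ x, f x ∂tilt φ (p δ)) _ _
      refine tendsto_of_forall_eventually_le
        (fun η hη => eventually_integral_tilt_le hφ hp' hp₀ f hη) fun η hη => ?_
      have h := eventually_integral_tilt_le hφ hp' hp₀ (-f) hη
      simpa only [BoundedContinuousFunction.coe_neg, Pi.neg_apply, integral_neg] using h
    exact (ProbabilityMeasure.continuous_pi.tendsto (fun _ : Fin j => lam)).comp
      (tendsto_pi_nhds.2 fun _ => hQ)

/-! ### Identification of the limit as a Gibbs measure with unique parameters. -/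

theorem pos_of_mem_admissible {a : Fin (m + 1) → ℝ} (ha : a ∈ admissible φ) (i : Fin (m + 1)) :
    0 < a i := by
  induction i using Fin.lastCases with
  | last =>
    by_contra h
    have h1 := ha.2
    rw [proj₂, ENNReal.ofReal_of_nonpos (not_lt.1 h)] at h1
    exact not_lt_zero h1
  | cast i => exact pos_of_mem_A₁ ha.1 i

theorem IsOptimal.posMoment_eq (hφ : Observables φ) {a P : Fin (m + 1) → ℝ} {δ : ℝ}
    (hP : IsOptimal φ a δ P) (i : Fin (m + 1)) :
    posMoment (φ i) (tilt φ P) = ENNReal.ofReal (tiltMoment φ P i) :=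
  posMoment_eq_ofReal_integral hφ (hP.integrable i)

/-- A Gibbs measure is determined by its moments. -/
theorem IsOptimal.gibbs_unique (hφ : Observables φ) {a b P : Fin (m + 1) → ℝ} {δ : ℝ}
    (hP : IsOptimal φ b δ P) (ha : ∀ i, 0 < a i) {q : Fin (m + 1) → ℝ} {i₀ : Fin (m + 1)}
    (h₀ : posMoment (φ i₀) (gibbs φ q) = ENNReal.ofReal (a i₀))
    (h : ∀ i, (P - Pi.single 0 1 : Fin (m + 1) → ℝ) i ≠ q i →
      tiltMoment φ P i = a i ∧ posMoment (φ i) (gibbs φ q) = ENNReal.ofReal (a i)) :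
    q = P - Pi.single 0 1 := by
  -- A positive moment excludes the zero measure, the default value of `gibbs` for a density that is
  -- not integrable.
  have hq : Normalizable φ (q + Pi.single 0 1) := normalizable_of_gibbs_ne_zero hφ fun h0 => by
    rw [h0] at h₀
    simp only [posMoment, lintegral_zero_measure] at h₀
    exact (ENNReal.ofReal_pos.2 (ha i₀)).ne h₀
  have hne : ∀ i, P i ≠ (q + Pi.single 0 1 : Fin (m + 1) → ℝ) i →
      (P - Pi.single 0 1 : Fin (m + 1) → ℝ) i ≠ q i := fun i hi h =>
    hi (by rw [Pi.add_apply, ← h, Pi.sub_apply, sub_add_cancel])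
  rw [gibbs_eq_tilt hφ] at h
  rw [eq_of_tiltMoment_eq hφ hP.normalizable hq (fun i _ => hP.integrable i)
    (fun i hi => integrable_of_posMoment_ne_top hφ
      ((h i (hne i hi)).2 ▸ ENNReal.ofReal_ne_top))
    fun i hi => (h i (hne i hi)).1.trans
      (integral_eq_of_posMoment_eq hφ (ha i).le (h i (hne i hi)).2).symm, add_sub_cancel_right]

end Microcanonical

theorem theorem1p0 {m : ℕ} (hm : 1 ≤ m) (φ : Fin (m + 1) → ℝ → ℝ)
    (hφ : Observables φ)
    (hg : ContinuousOn (g₁ φ) (A₁ φ))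
    (a : Fin (m + 1) → ℝ) (ha : a ∈ admissible φ) :
    ∃ lam : ProbabilityMeasure PosReal,
      (∀ j : ℕ, 0 < j → HasIteratedWeakLimit
        (fun n δ => marginal φ a j n δ)
        (ProbabilityMeasure.pi (fun _ : Fin j => lam))) ∧
      (proj₁ a ∈ S₁ φ ∧
          g₂ φ (proj₁ a) ≤ proj₂ a →
        (∃ p : Fin m → ℝ,
          (lam : Measure PosReal) =
            gibbs φ (extendBy p 0) ∧
          (∀ i : Fin m, posMoment (φ i.castSucc) lam =
            ENNReal.ofReal (a i.castSucc)) ∧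
          (∀ q : Fin m → ℝ,
            (∀ i : Fin m, posMoment (φ i.castSucc)
              (gibbs φ (extendBy q 0)) =
                ENNReal.ofReal (a i.castSucc)) → q = p)) ∧
        posMoment (φ (Fin.last m)) lam =
          ENNReal.ofReal (g₂ φ (proj₁ a))) ∧
      (proj₁ a ∈ S₂ φ ∨
          (proj₁ a ∈ S₁ φ ∧
            proj₂ a < g₂ φ (proj₁ a)) →
        ∃ p : Fin (m + 1) → ℝ, p (Fin.last m) < 0 ∧
          (lam : Measure PosReal) = gibbs φ p ∧
          (∀ i, posMoment (φ i) lam = ENNReal.ofReal (a i)) ∧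
          (∀ q : Fin (m + 1) → ℝ,
            (∀ i, posMoment (φ i) (gibbs φ q) =
              ENNReal.ofReal (a i)) → q = p)) := by
  obtain ⟨P, hP, hlost, hkept⟩ := exists_isOptimal_zero hm hφ hg ha
  have hpos := pos_of_mem_admissible ha
  -- Gibbs parameters refer to Lebesgue measure and `P` to the density `exp (-φ 0)`, whence the
  -- shift of the first coordinate. Since `1 ≤ m`, the last coordinate is not affected.
  have hlast : (P - Pi.single 0 1 : Fin (m + 1) → ℝ) (Fin.last m) = P (Fin.last m) := by
    simp [last_ne_zero hm]
  have hgibbs : tilt φ P = gibbs φ (P - Pi.single 0 1) := refLaw_tilted hφ P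
  refine ⟨⟨tilt φ P, isProbabilityMeasure_tilt hφ hP.normalizable⟩,
    fun j hj => hasIteratedWeakLimit_marginal hm hφ hg ha hP rfl hj, fun hcase => ?_,
    fun hcase => ?_⟩
  · obtain ⟨h0, hg₂⟩ := hlost hcase
    have hext : extendBy (proj₁ (P - Pi.single 0 1 : Fin (m + 1) → ℝ)) 0 = P - Pi.single 0 1 := by
      rw [← h0, ← hlast, extendBy_proj]
    refine ⟨⟨proj₁ (P - Pi.single 0 1 : Fin (m + 1) → ℝ), by rw [hext]; exact hgibbs,
      fun i => ?_, fun q hq => ?_⟩, ?_⟩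
    · exact (hP.posMoment_eq hφ _).trans (by rw [hP.tiltMoment_eq])
    -- Both last parameters vanish, so the last moment, which differs from `a` when the constraint
    -- is lost, is not needed.
    · have := hP.gibbs_unique hφ hpos (hq ⟨0, hm⟩) fun i hi => by
        induction i using Fin.lastCases with
        | last => exact absurd (by rw [hlast, h0, extendBy_last]) hi
        | cast i => exact ⟨hP.tiltMoment_eq i, hq i⟩
      rw [← this]
      funext i
      simp [proj₁]
    · exact (hP.posMoment_eq hφ _).trans (by rw [hg₂])
  · have hneg := hkept hcase
    have hmom : ∀ i, tiltMoment φ P i = a i := fun i => by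
      induction i using Fin.lastCases with
      | last => exact hP.tiltMoment_last_eq hneg
      | cast i => exact hP.tiltMoment_eq i
    exact ⟨P - Pi.single 0 1, hlast ▸ hneg, hgibbs,
      fun i => (hP.posMoment_eq hφ i).trans (by rw [hmom]),
      fun q hq => hP.gibbs_unique hφ hpos (hq 0) fun i _ => ⟨hmom i, hq i⟩⟩
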